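/- Let $\Gamma$ be a distance-regular graph with vertex set $X$, that is, a finite connected simple graph such that for all integers $h,i,j\ge 0$ the number of vertices at distance $i$ from $y$ and distance $j$ from $z$ is the same for all vertices $y,z$ at distance $\partial(y,z)=h$. Assume that the diameter $D$ of $\Gamma$ is at least $3$. Let $\mathbb F=\mathbb R$ or $\mathbb F=\mathbb C$. For $0\le i\le D$ let $A_i\in\mathrm{Mat}_X(\mathbb F)$ be the $i$-th distance matrix, with $(y,z)$-entry $1$ if $\partial(y,z)=i$ and $0$ otherwise, and write $A=A_1$. The matrix $A$ is diagonalizable with exactly $D+1$ distinct eigenvalues; let $\theta_0,\theta_1,\ldots,\theta_D$ be an ordering of them in which $\theta_0$ is the valency of $\Gamma$, and for $0\le i\le D$ let $E_i\in\mathrm{Mat}_X(\mathbb F)$ be the primitive idempotent of $A$ for $\theta_i$, that is, the matrix acting as the identity on the $\theta_i$-eigenspace of $A$ and as $0$ on every other eigenspace of $A$. Let $q^h_{i,j}$ $(0\le h,i,j\le D)$ be the Krein parameters, defined by $E_i\circ E_j=|X|^{-1}\sum_{h=0}^D q^h_{i,j}E_h$, where $\circ$ is the entrywise product. Assume that the ordering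 $\{E_i\}_{i=0}^D$ is $Q$-polynomial: for $0\le h,i,j\le D$, $q^h_{i,j}=0$ if one of $h,i,j$ is greater than the sum of the other two, and $q^h_{i,j}\ne0$ if one of $h,i,j$ is equal to the sum of the other two. Fix a vertex $x\in X$. For $0\le i\le D$ let $E_i^*\in\mathrm{Mat}_X(\mathbb F)$ be the diagonal matrix with $(y,y)$-entry $1$ if $\partial(x,y)=i$ and $0$ otherwise. Let $T=T(x)$ be the Terwilliger algebra, that is, the subalgebra of $\mathrm{Mat}_X(\mathbb F)$ generated by $A_0,\ldots,A_D,E_0^*,\ldots,E_D^*$. Then for each $e\in\{E_1^*,\,E_1,\,E_D^*,\,E_D\}$ the space $eTe=\{eBe : B\in T\}$ is an algebra under matrix multiplication, with identity $e$; this algebra is commutative, and every element of it is a symmetric matrix (equal to its transpose). -/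

import Mathlib

open scoped Matrix

noncomputable section

namespace QPolyDRG

/-- A finite connected simple graph is *distance-regular* if, for all `h i j`, the number of
vertices at distance `i` from `y` and at distance `j` from `z` is the same for all pairs `y, z` of
vertices at distance `h`. (When one of `h, i, j` exceeds the diameter the condition is trivial.) -/
structure IsDistanceRegular {X : Type*} [Fintype X] (G : SimpleGraph X) : Prop where
  connected : G.Connected
  card_eq : ∀ (h i j : ℕ) (y z y' z' : X), G.dist y z = h → G.dist y' z' = h →
    (Finset.univ.filter fun w => G.dist y w = i ∧ G.dist z w = j).card =
      (Finset.univ.filter fun w => G.dist y' w = i ∧ G.dist z' w = j).card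

variable {X : Type*} [Fintype X] [DecidableEq X]

/-- The `i`-th distance matrix `A_i`; `A_1` is the adjacency matrix. -/
def distMatrix (𝕜 : Type*) [RCLike 𝕜] (G : SimpleGraph X) (i : ℕ) : Matrix X X 𝕜 :=
  Matrix.of fun y z => if G.dist y z = i then 1 else 0

/-- The `i`-th dual primitive idempotent `E_i^*` with respect to the base vertex `x`. -/
def dualIdempotent (𝕜 : Type*) [RCLike 𝕜] (G : SimpleGraph X) (x : X) (i : ℕ) : Matrix X X 𝕜 :=
  Matrix.diagonal fun y => if G.dist x y = i then 1 else 0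

/-- The Bose-Mesner algebra `M`, the span of the distance matrices
(those with index larger than the diameter are zero). -/
def boseMesner (𝕜 : Type*) [RCLike 𝕜] (G : SimpleGraph X) : Submodule 𝕜 (Matrix X X 𝕜) :=
  Submodule.span 𝕜 (Set.range (distMatrix 𝕜 G))

/-- The dual Bose-Mesner algebra `M^*` with respect to `x`, the span of the dual primitive
idempotents (those with index larger than the diameter are zero). -/
def dualBoseMesner (𝕜 : Type*) [RCLike 𝕜] (G : SimpleGraph X) (x : X) :
    Submodule 𝕜 (Matrix X X 𝕜) :=
  Submodule.span 𝕜 (Set.range (dualIdempotent 𝕜 G x))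

/-- The Terwilliger algebra `T = T(x)`: the subalgebra of the full matrix algebra generated by
`M` and `M^*`. -/
def terwilliger (𝕜 : Type*) [RCLike 𝕜] (G : SimpleGraph X) (x : X) :
    Subalgebra 𝕜 (Matrix X X 𝕜) :=
  Algebra.adjoin 𝕜 ((boseMesner 𝕜 G : Set (Matrix X X 𝕜)) ∪ dualBoseMesner 𝕜 G x)

/-- `E_0, …, E_D` is an ordering of the primitive idempotents of the adjacency matrix `A = A_1`:
there is an enumeration `θ_0, …, θ_D` without repetition of all eigenvalues of `A`, with `θ_0` the
valency, such that `E_i` is the identity on the eigenspace of `θ_i` and zero on the eigenspaces of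
the other eigenvalues. -/
def IsIdempotentOrdering {𝕜 : Type*} [RCLike 𝕜] (G : SimpleGraph X) {D : ℕ}
    (E : Fin (D + 1) → Matrix X X 𝕜) : Prop :=
  ∃ θ : Fin (D + 1) → 𝕜,
    Function.Injective θ ∧
    (∀ μ : 𝕜, Module.End.HasEigenvalue (Matrix.toLin' (distMatrix 𝕜 G 1)) μ ↔ ∃ i, θ i = μ) ∧
    (∀ y : X, θ 0 = ((Finset.univ.filter fun z => G.dist y z = 1).card : 𝕜)) ∧
    ∀ i j : Fin (D + 1), ∀ v ∈ Module.End.eigenspace (Matrix.toLin' (distMatrix 𝕜 G 1)) (θ j),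
      E i *ᵥ v = if i = j then v else 0

/-- `q h i j` are the Krein parameters `q^h_{i,j}`: the coefficients in the expansion
`E_i ∘ E_j = |X|⁻¹ ∑_h q^h_{i,j} E_h` of the entrywise products. -/
def IsKreinParameters {𝕜 : Type*} [RCLike 𝕜] {D : ℕ} (E : Fin (D + 1) → Matrix X X 𝕜)
    (q : Fin (D + 1) → Fin (D + 1) → Fin (D + 1) → 𝕜) : Prop :=
  ∀ i j, E i ⊙ E j = (Fintype.card X : 𝕜)⁻¹ • ∑ h, q h i j • E h

/-- The ordering `E_0, …, E_D` is `Q`-polynomial: its Krein parameters `q^h_{i,j}` vanish if one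
of `h, i, j` is greater than the sum of the other two, and do not vanish if one of them is equal
to the sum of the other two. The primitive idempotents are linearly independent and
their span is closed under entrywise products, so the Krein parameters exist and are unique. -/
def IsQPolynomial {𝕜 : Type*} [RCLike 𝕜] {D : ℕ} (E : Fin (D + 1) → Matrix X X 𝕜) : Prop :=
  ∃ q : Fin (D + 1) → Fin (D + 1) → Fin (D + 1) → 𝕜,
    IsKreinParameters E q ∧
    (∀ h i j : Fin (D + 1),
      ((h : ℕ) > i + j ∨ (i : ℕ) > h + j ∨ (j : ℕ) > h + i) → q h i j = 0) ∧
    (∀ h i j : Fin (D + 1),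
      ((h : ℕ) = i + j ∨ (i : ℕ) = h + j ∨ (j : ℕ) = h + i) → q h i j ≠ 0)

/-- The space `e T e = {e B e | B ∈ T}`. -/
def corner {𝕜 : Type*} [RCLike 𝕜] (T : Subalgebra 𝕜 (Matrix X X 𝕜)) (e : Matrix X X 𝕜) :
    Submodule 𝕜 (Matrix X X 𝕜) :=
  (Subalgebra.toSubmodule T).map (LinearMap.mulLeftRight 𝕜 (e, e))

/-- The subspace `S` is an associative algebra under matrix multiplication, with identity `e`. -/
structure IsAlgebraWithOne {𝕜 : Type*} [RCLike 𝕜] (S : Submodule 𝕜 (Matrix X X 𝕜))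
    (e : Matrix X X 𝕜) : Prop where
  one_mem : e ∈ S
  mul_mem : ∀ a ∈ S, ∀ b ∈ S, a * b ∈ S
  one_mul : ∀ a ∈ S, e * a = a
  mul_one : ∀ a ∈ S, a * e = a

end QPolyDRG

end

/-! Products of elements of `e T e` lie in `e T e`, so it is enough that every `e B e` is symmetric:
then `a b = (a b)ᵀ = b a`. Let `A* = ∑ f i • E_i^*` be the diagonal matrix of the row `x` of `E_1`.
The triangle inequality gives `E_i^* A E_j^* = 0`, and `q^1_{i,j} = 0` gives `E_i A* E_j = 0`,
whenever `|i - j| > 1`. The eigenvalues of `A*` are distinct, so `A` and `A*` generate `T`, and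
transposition is an antiautomorphism fixing all `E_i` and `E_i^*`. From here on the roles of the two
families can be exchanged and the order of either one reversed.

The core is abstract. Let `e = E false a` be at an end of its ordering. The corner at `e` is spanned
by the words `e x₀ x₁ ⋯ x₂ₙ e` with factors alternately in `diag true` and `diag false`. Two facts
carry the proof. (1) The elements `e x e` with `x ∈ diag true` commute (`IsBase.corner_comm`). More
generally `e x y z e` is symmetric in `x, z`, by induction on the degree of `y` as a polynomial in
`A false`. (2) Every word is fixed by the antiautomorphism and commutes with all `e x e`
(`IsBase.words_le`). By induction on the degree of one factor, bandedness and Vandermonde systems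
lower the degree or move the factor towards an end. There, `e` sees only few eigenspaces, so the
degree drops again or an `e x e` splits off. In degree zero the neighbouring factors merge and the
word is shorter.

This settles `E_D^*` and `E_D` after reversal. For index `1`, let `P` be the projection onto the
functions constant on the spheres around `x`. It commutes with `T` and absorbs `E_0` and `E_0^*`. On
the range of `1 - P` the index `1` is therefore at the end, and (1), (2) apply. On the range of `P`
the corner is spanned by one symmetric matrix `e F e` with `F` of rank one (`transpose_mul_corner`).
-/

section

/-! ### Tridiagonal systems and Vandermonde elimination. -/

open Finset

/-- Two families of pairwise orthogonal idempotents `E true 0, E true 1, …` and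
`E false 0, E false 1, …` of an algebra, each with sum `1`, and elements `A true`, `A false` that
have these as primitive idempotents, such that each of `A true`, `A false` acts on the idempotents
of the other one in a block-tridiagonal fashion. -/
structure TridiagonalSystem (K R : Type*) [Field K] [Ring R] [Algebra K R] where
  E : Bool → ℕ → R
  θ : Bool → ℕ → K
  size : Bool → ℕ
  mul_self : ∀ b i, E b i * E b i = E b i
  mul_of_ne : ∀ b i j, i ≠ j → E b i * E b j = 0
  sum_eq_one : ∀ b, ∑ i ∈ range (size b), E b i = 1
  injOn : ∀ b, Set.InjOn (θ b) (range (size b))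
  tridiagonal : ∀ b i j, (i + 1 < j ∨ j + 1 < i) →
    E b i * (∑ l ∈ range (size !b), θ (!b) l • E (!b) l) * E b j = 0

/-- A finitely supported vector-valued function which is orthogonal to the powers of degree
less than the size of its support vanishes. -/
theorem eq_zero_of_sum_pow_smul_eq_zero {K N : Type*} [Field K] [AddCommGroup N] [Module K N]
    {t s : Finset ℕ} {θ : ℕ → K} (hθ : Set.InjOn θ t) (v : ℕ → N)
    (hv : ∀ i ∈ t, i ∉ s → v i = 0) (c : ℕ) (hc : s.card ≤ c)
    (h : ∀ m < c, ∑ i ∈ t, θ i ^ m • v i = 0) : ∀ i ∈ t, v i = 0 := by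
  classical
  intro i hi
  by_cases his : i ∈ s
  swap
  · exact hv i hi his
  set u := t ∩ s with hu
  have hinj : Set.InjOn θ u := hθ.mono (by simp [hu])
  have hiu : i ∈ u := by simp [hu, hi, his]
  -- The Lagrange polynomial of `i` on the support has degree below `c`; pairing it with `v`
  -- isolates `v i`.
  have hcard : u.card ≤ s.card := card_le_card inter_subset_right
  have hpos : 0 < u.card := card_pos.2 ⟨i, hiu⟩
  set p := Lagrange.basis u θ i with hp
  have hdeg : p.natDegree < c := by
    rw [hp, Lagrange.natDegree_basis hinj hiu]; omega
  have h1 : ∑ j ∈ t, p.eval (θ j) • v j = 0 := by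
    simp_rw [Polynomial.eval_eq_sum_range' hdeg, Finset.sum_smul, mul_smul]
    rw [Finset.sum_comm]
    refine Finset.sum_eq_zero fun m hm => ?_
    rw [← Finset.smul_sum, h m (mem_range.1 hm), smul_zero]
  rw [Finset.sum_eq_single i] at h1
  · rwa [hp, Lagrange.eval_basis_self hinj hiu, one_smul] at h1
  · intro j hj hji
    by_cases hjs : j ∈ s
    · rw [hp, Lagrange.eval_basis_of_ne hji.symm (by simp [hu, hj, hjs]), zero_smul]
    · rw [hv j hj hjs, smul_zero]
  · exact fun h => absurd hi h

/-! ### Polynomials in `A b`, filtered by degree, and the algebra spanned by the idempotents. -/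

namespace TridiagonalSystem

variable {K R : Type*} [Field K] [Ring R] [Algebra K R] (S : TridiagonalSystem K R)

/-- The element with eigenvalues `θ b i` and primitive idempotents `E b i`. -/
def A (b : Bool) : R := ∑ i ∈ range (S.size b), S.θ b i • S.E b i

/-- The span of the idempotents `E b i`. -/
def diag (b : Bool) : Submodule K R := Submodule.span K (Set.range (S.E b))

/-- The polynomials in `A b` of degree at most `m`. -/
def filt (b : Bool) (m : ℕ) : Submodule K R :=
  Submodule.span K ((fun k => S.A b ^ k) '' Set.Iic m)

theorem tri (b : Bool) (i j : ℕ) (h : i + 1 < j ∨ j + 1 < i) :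
    S.E b i * S.A (!b) * S.E b j = 0 := S.tridiagonal b i j h

theorem E_eq_zero {b : Bool} {i : ℕ} (h : S.size b ≤ i) : S.E b i = 0 := by
  rw [← mul_one (S.E b i), ← S.sum_eq_one b, Finset.mul_sum]
  refine Finset.sum_eq_zero fun j hj => S.mul_of_ne _ _ _ ?_
  have := mem_range.1 hj
  omega

theorem A_mul_E (b : Bool) (i : ℕ) : S.A b * S.E b i = S.θ b i • S.E b i := by
  rcases lt_or_ge i (S.size b) with h | h
  · rw [A, Finset.sum_mul, Finset.sum_eq_single i]
    · rw [smul_mul_assoc, S.mul_self]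
    · intro j _ hj
      rw [smul_mul_assoc, S.mul_of_ne _ _ _ hj, smul_zero]
    · intro hi
      exact absurd (mem_range.2 h) hi
  · simp [S.E_eq_zero h]

theorem E_mul_A (b : Bool) (i : ℕ) : S.E b i * S.A b = S.θ b i • S.E b i := by
  rcases lt_or_ge i (S.size b) with h | h
  · rw [A, Finset.mul_sum, Finset.sum_eq_single i]
    · rw [mul_smul_comm, S.mul_self]
    · intro j _ hj
      rw [mul_smul_comm, S.mul_of_ne _ _ _ hj.symm, smul_zero]
    · intro hi
      exact absurd (mem_range.2 h) hi
  · simp [S.E_eq_zero h]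

theorem pow_mul_E (b : Bool) (i k : ℕ) : S.A b ^ k * S.E b i = S.θ b i ^ k • S.E b i := by
  induction k with
  | zero => simp
  | succ k ih => rw [pow_succ, mul_assoc, A_mul_E, mul_smul_comm, ih, smul_smul, pow_succ']

theorem E_mul_pow (b : Bool) (i k : ℕ) : S.E b i * S.A b ^ k = S.θ b i ^ k • S.E b i := by
  induction k with
  | zero => simp
  | succ k ih => rw [pow_succ', ← mul_assoc, E_mul_A, smul_mul_assoc, ih, smul_smul, pow_succ']

theorem pow_eq_sum (b : Bool) (k : ℕ) :
    S.A b ^ k = ∑ i ∈ range (S.size b), S.θ b i ^ k • S.E b i := by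
  rw [← mul_one (S.A b ^ k), ← S.sum_eq_one b, Finset.mul_sum]
  exact Finset.sum_congr rfl fun i _ => S.pow_mul_E b i k

theorem E_mem_diag (b : Bool) (i : ℕ) : S.E b i ∈ S.diag b :=
  Submodule.subset_span ⟨i, rfl⟩

theorem pow_mem_filt (b : Bool) {k m : ℕ} (h : k ≤ m) : S.A b ^ k ∈ S.filt b m :=
  Submodule.subset_span ⟨k, h, rfl⟩

theorem filt_le_diag (b : Bool) (m : ℕ) : S.filt b m ≤ S.diag b := by
  rw [filt, Submodule.span_le]
  rintro _ ⟨k, -, rfl⟩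
  change S.A b ^ k ∈ S.diag b
  rw [pow_eq_sum]
  exact Submodule.sum_mem _ fun i _ => Submodule.smul_mem _ _ (S.E_mem_diag b i)

theorem one_mem_diag (b : Bool) : (1 : R) ∈ S.diag b := by
  rw [← S.sum_eq_one b]
  exact Submodule.sum_mem _ fun i _ => S.E_mem_diag b i

theorem A_mem_diag (b : Bool) : S.A b ∈ S.diag b :=
  Submodule.sum_mem _ fun i _ => Submodule.smul_mem _ _ (S.E_mem_diag b i)

theorem filt_zero (b : Bool) : S.filt b 0 = 1 := by
  rw [filt, Submodule.one_eq_span]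
  congr 1
  ext x
  simp [eq_comm]

theorem diag_mul_diag (b : Bool) : S.diag b * S.diag b = S.diag b := by
  apply le_antisymm
  · rw [diag, Submodule.span_mul_span, Submodule.span_le]
    rintro _ ⟨_, ⟨i, rfl⟩, _, ⟨j, rfl⟩, rfl⟩
    change S.E b i * S.E b j ∈ S.diag b
    by_cases h : i = j
    · subst h
      rw [S.mul_self]
      exact S.E_mem_diag b i
    · rw [S.mul_of_ne _ _ _ h]
      exact Submodule.zero_mem _
  · intro x hx
    rw [← mul_one x]
    exact Submodule.mul_mem_mul hx (S.one_mem_diag b)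

theorem diag_comm (b : Bool) {x y : R} (hx : x ∈ S.diag b) (hy : y ∈ S.diag b) :
    x * y = y * x := by
  induction hx using Submodule.span_induction with
  | mem x hx =>
    obtain ⟨i, rfl⟩ := hx
    induction hy using Submodule.span_induction with
    | mem y hy =>
      obtain ⟨j, rfl⟩ := hy
      by_cases h : i = j
      · rw [h]
      · rw [S.mul_of_ne _ _ _ h, S.mul_of_ne _ _ _ (Ne.symm h)]
    | zero => simp
    | add x y _ _ h1 h2 => rw [mul_add, add_mul, h1, h2]
    | smul a x _ h => rw [mul_smul_comm, smul_mul_assoc, h]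
  | zero => simp
  | add x y _ _ h1 h2 => rw [mul_add, add_mul, h1, h2]
  | smul a x _ h => rw [mul_smul_comm, smul_mul_assoc, h]

/-- Elements of `filt b m` can be prescribed on `m + 1` eigenspaces. -/
theorem exists_interpolant (b : Bool) (f : ℕ → K) (s : Finset ℕ) (hs : s ⊆ range (S.size b))
    (m : ℕ) (hm : s.card ≤ m + 1) :
    ∃ y ∈ S.filt b m, ∀ i ∈ s, y * S.E b i = f i • S.E b i ∧ S.E b i * y = f i • S.E b i := by
  have hinj : Set.InjOn (S.θ b) s := (S.injOn b).mono (by exact_mod_cast hs)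
  set p := Lagrange.interpolate s (S.θ b) f with hp
  have hdeg : p.natDegree < m + 1 := by
    by_cases h0 : p = 0
    · rw [h0]; simp
    · rw [Polynomial.natDegree_lt_iff_degree_lt h0]
      exact lt_of_lt_of_le (Lagrange.degree_interpolate_lt f hinj) (by exact_mod_cast hm)
  refine ⟨Polynomial.aeval (S.A b) p, ?_, fun i hi => ?_⟩
  · rw [Polynomial.aeval_eq_sum_range' hdeg]
    exact Submodule.sum_mem _ fun k hk => Submodule.smul_mem _ _
      (S.pow_mem_filt b (by have := mem_range.1 hk; omega))
  · rw [← Lagrange.eval_interpolate_at_node f hinj hi, ← hp, Polynomial.aeval_eq_sum_range' hdeg,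
      Polynomial.eval_eq_sum_range' hdeg]
    simp_rw [Finset.sum_mul, Finset.mul_sum, Finset.sum_smul, smul_mul_assoc, mul_smul_comm,
      pow_mul_E, E_mul_pow, smul_smul, and_self]

theorem eq_of_mul_E {b : Bool} {x y : R} (h : ∀ i < S.size b, x * S.E b i = y * S.E b i) :
    x = y := by
  rw [← mul_one x, ← mul_one y, ← S.sum_eq_one b, Finset.mul_sum, Finset.mul_sum]
  exact Finset.sum_congr rfl fun i hi => h i (mem_range.1 hi)

theorem diag_le_filt (b : Bool) : S.diag b ≤ S.filt b (S.size b) := by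
  rw [diag, Submodule.span_le]
  rintro _ ⟨i, rfl⟩
  obtain ⟨y, hy, h⟩ := S.exists_interpolant b (Pi.single i 1) (range (S.size b)) subset_rfl
    (S.size b) (by simp)
  have : S.E b i = y := by
    refine S.eq_of_mul_E (b := b) fun j hj => ?_
    rw [(h j (mem_range.2 hj)).1]
    by_cases hij : i = j
    · subst hij; rw [S.mul_self]; simp
    · rw [S.mul_of_ne _ _ _ hij]; simp [Ne.symm hij]
  rw [this]
  exact hy

/-- The eigenvalue of an element of `diag b` on the `i`-th eigenspace. -/
theorem exists_eigenvalue {b : Bool} {x : R} (hx : x ∈ S.diag b) :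
    ∃ f : ℕ → K, ∀ i, x * S.E b i = f i • S.E b i ∧ S.E b i * x = f i • S.E b i := by
  induction hx using Submodule.span_induction with
  | mem x hx =>
    obtain ⟨j, rfl⟩ := hx
    refine ⟨fun i => if i = j then 1 else 0, fun i => ?_⟩
    by_cases hij : i = j
    · subst hij; simp [S.mul_self]
    · simp [S.mul_of_ne b _ _ hij, S.mul_of_ne b _ _ (Ne.symm hij), hij]
  | zero => exact ⟨0, by simp⟩
  | add x y _ _ h1 h2 =>
    obtain ⟨f, hf⟩ := h1
    obtain ⟨g, hg⟩ := h2
    exact ⟨f + g, fun i => by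
      simp [add_mul, mul_add, (hf i).1, (hf i).2, (hg i).1, (hg i).2, add_smul]⟩
  | smul a x _ h =>
    obtain ⟨f, hf⟩ := h
    exact ⟨a • f, fun i => by simp [(hf i).1, (hf i).2, smul_smul]⟩

theorem mul_eq_sum_mul_E_mul (b : Bool) (x y : R) :
    x * y = ∑ l ∈ range (S.size b), x * S.E b l * y := by
  rw [← Finset.sum_mul, ← Finset.mul_sum, S.sum_eq_one, mul_one]

/-- Each factor `A (!b)` moves the index by at most one. -/
theorem E_mul_pow_mul_E (b : Bool) (k : ℕ) : ∀ i j, (i + k < j ∨ j + k < i) →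
    S.E b i * S.A (!b) ^ k * S.E b j = 0 := by
  induction k with
  | zero =>
    intro i j h
    rw [pow_zero, mul_one]
    exact S.mul_of_ne _ _ _ (by omega)
  | succ k ih =>
    intro i j h
    rw [pow_succ, ← mul_assoc, mul_assoc _ (S.A !b), S.mul_eq_sum_mul_E_mul b]
    refine Finset.sum_eq_zero fun l _ => ?_
    by_cases hl : l + 1 < j ∨ j + 1 < l
    · rw [← S.mul_self b l, mul_assoc, mul_assoc (S.E b l), ← mul_assoc _ (S.A !b),
        S.tri b l j hl, mul_zero, mul_zero]
    · rw [ih i l (by omega), zero_mul]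

theorem E_mul_filt_mul_E {b : Bool} {m : ℕ} {y : R} (hy : y ∈ S.filt (!b) m) {i j : ℕ}
    (h : i + m < j ∨ j + m < i) : S.E b i * y * S.E b j = 0 := by
  induction hy using Submodule.span_induction with
  | mem y hy =>
    obtain ⟨k, hk, rfl⟩ := hy
    have hk : k ≤ m := hk
    exact S.E_mul_pow_mul_E b k i j (by omega)
  | zero => simp
  | add x y _ _ h1 h2 => rw [mul_add, add_mul, h1, h2, add_zero]
  | smul a x _ h => rw [mul_smul_comm, smul_mul_assoc, h, smul_zero]

/-! ### Corners at the end of the ordering: commutativity of the elements `e * x * e`. -/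

/-- The eigenspaces of `A false` with index less than `a` are decoupled from the other ones. -/
def IsBase (a : ℕ) : Prop :=
  ∀ i j, i < a → a ≤ j →
    S.E false i * S.A true * S.E false j = 0 ∧ S.E false j * S.A true * S.E false i = 0

variable {S} {a : ℕ}

theorem IsBase.pow (ha : S.IsBase a) (k : ℕ) : ∀ i j, i < a → a ≤ j →
    S.E false i * S.A true ^ k * S.E false j = 0 ∧
      S.E false j * S.A true ^ k * S.E false i = 0 := by
  induction k with
  | zero =>
    intro i j hi hj
    rw [pow_zero, mul_one, mul_one]
    exact ⟨S.mul_of_ne _ _ _ (by omega), S.mul_of_ne _ _ _ (by omega)⟩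
  | succ k ih =>
    intro i j hi hj
    have key : ∀ i j l, S.E false i * S.A true ^ k * S.E false l = 0 ∨
        S.E false l * S.A true * S.E false j = 0 →
        S.E false i * S.A true ^ k * S.E false l * (S.A true * S.E false j) = 0 := by
      rintro i j l (h | h)
      · rw [h, zero_mul]
      · rw [← S.mul_self false l, mul_assoc, mul_assoc (S.E false l), ← mul_assoc _ (S.A true), h,
          mul_zero, mul_zero]
    constructor
    · rw [pow_succ, ← mul_assoc, mul_assoc _ (S.A true), S.mul_eq_sum_mul_E_mul false]
      refine Finset.sum_eq_zero fun l _ => key _ _ _ ?_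
      rcases lt_or_ge l a with hl | hl
      · exact Or.inr (ha l j hl hj).1
      · exact Or.inl (ih i l hi hl).1
    · rw [pow_succ, ← mul_assoc, mul_assoc _ (S.A true), S.mul_eq_sum_mul_E_mul false]
      refine Finset.sum_eq_zero fun l _ => key _ _ _ ?_
      rcases lt_or_ge l a with hl | hl
      · exact Or.inl (ih l j hl hj).2
      · exact Or.inr (ha i l hi hl).2

/-- Decoupling bounds the reachable indices from below and the degree bounds them from above: from
`a`, an element of degree `k` reaches only the `k + 1` indices `a, …, a + k`. All replacements below
are interpolations on this window. -/
theorem IsBase.filt (ha : S.IsBase a) {k : ℕ} {x : R} (hx : x ∈ S.filt true k) {j : ℕ}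
    (hj : j < a ∨ a + k < j) :
    S.E false a * x * S.E false j = 0 ∧ S.E false j * x * S.E false a = 0 := by
  rcases hj with hj | hj
  · induction hx using Submodule.span_induction with
    | mem y hy =>
      obtain ⟨k, hk, rfl⟩ := hy
      exact (ha.pow k j a hj le_rfl).symm
    | zero => simp
    | add x y _ _ h1 h2 => rw [mul_add, add_mul, h1.1, h2.1, mul_add, add_mul, h1.2, h2.2]; simp
    | smul a x _ h => rw [mul_smul_comm, smul_mul_assoc, h.1, mul_smul_comm, smul_mul_assoc, h.2]; simp
  · exact ⟨S.E_mul_filt_mul_E (b := false) hx (by omega),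
      S.E_mul_filt_mul_E (b := false) hx (by omega)⟩

/-- Next to `E false a * filt true k`, an element of `diag false` can be replaced by
a polynomial of degree at most `k`. -/
theorem IsBase.exists_replace (ha : S.IsBase a) (k : ℕ) {y : R} (hy : y ∈ S.diag false) :
    ∃ y' ∈ S.filt false k, ∀ x ∈ S.filt true k,
      S.E false a * x * y = S.E false a * x * y' ∧ y * x * S.E false a = y' * x * S.E false a := by
  obtain ⟨f, hf⟩ := S.exists_eigenvalue hy
  -- The window has at most `k + 1` indices, so degree `k` suffices to match the eigenvalues of `y`
  -- on it. The filter removes indices whose idempotents are zero.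
  obtain ⟨y', hy', h⟩ := S.exists_interpolant false f
    ((Finset.Icc a (a + k)).filter (· < S.size false)) (by intro i; simp) k
    ((card_filter_le _ _).trans (by simp; omega))
  refine ⟨y', hy', fun x hx => ⟨?_, ?_⟩⟩
  · rw [S.mul_eq_sum_mul_E_mul false, S.mul_eq_sum_mul_E_mul false _ y']
    refine Finset.sum_congr rfl fun l hl => ?_
    by_cases hla : l < a ∨ a + k < l
    · rw [(ha.filt hx hla).1, zero_mul, zero_mul]
    · have := mem_range.1 hl
      rw [mul_assoc _ _ y, mul_assoc _ _ y', (hf l).2, (h l (by simp; omega)).2]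
  · rw [mul_assoc, mul_assoc, S.mul_eq_sum_mul_E_mul false, S.mul_eq_sum_mul_E_mul false y']
    refine Finset.sum_congr rfl fun l hl => ?_
    by_cases hla : l < a ∨ a + k < l
    · rw [mul_assoc, ← mul_assoc _ x, (ha.filt hx hla).2, mul_zero,
        mul_assoc y', ← mul_assoc _ x, (ha.filt hx hla).2, mul_zero]
    · have := mem_range.1 hl
      rw [(hf l).1, (h l (by simp; omega)).1]

/-- Next to `E false a * filt true (k + 1)`, an element of `diag false` can be replaced by
a polynomial of degree at most `k`, up to a multiple of `E false a`. -/
theorem IsBase.exists_replace_succ (ha : S.IsBase a) (k : ℕ) {y : R} (hy : y ∈ S.diag false) :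
    ∃ y' ∈ S.filt false k, ∃ c : K, ∀ x ∈ S.filt true (k + 1),
      S.E false a * x * y = S.E false a * x * y' + c • (S.E false a * x * S.E false a) := by
  obtain ⟨f, hf⟩ := S.exists_eigenvalue hy
  -- The window `a, …, a + k + 1` has one index too many for degree `k`. Interpolation omits `a`,
  -- and the error there, `f a - g a`, becomes the constant `c`.
  obtain ⟨y', hy', h⟩ := S.exists_interpolant false f
    ((Finset.Icc (a + 1) (a + 1 + k)).filter (· < S.size false)) (by intro i; simp) k
    ((card_filter_le _ _).trans (by simp; omega))
  obtain ⟨g, hg⟩ := S.exists_eigenvalue (S.filt_le_diag _ _ hy')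
  refine ⟨y', hy', f a - g a, fun x hx => ?_⟩
  rw [← sub_eq_iff_eq_add', ← mul_sub, S.mul_eq_sum_mul_E_mul false]
  rcases lt_or_ge a (S.size false) with has | has
  · rw [Finset.sum_eq_single a]
    · rw [mul_assoc, mul_sub, (hf a).2, (hg a).2, ← sub_smul, mul_smul_comm]
    · intro l hl hne
      by_cases hla : l < a ∨ a + (k + 1) < l
      · rw [(ha.filt hx hla).1, zero_mul]
      · have := mem_range.1 hl
        rw [mul_assoc, mul_sub, (hf l).2, (h l (by simp; omega)).2, sub_self, mul_zero]
    · intro h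
      exact absurd (mem_range.2 has) h
  · simp [S.E_eq_zero has]

/-- Since `x` has degree at most `k` and stands next to `e`, the middle factor `y` may be replaced
by a `y'` of degree `k`. The same `y'` works at the left and at the right end, so it can be turned
back into `y` after the swap. -/
theorem IsBase.swap_of_swap_filt (ha : S.IsBase a) {k : ℕ}
    (h : ∀ y ∈ S.filt false k, ∀ x ∈ S.diag true, ∀ z ∈ S.diag true,
      S.E false a * x * y * z * S.E false a = S.E false a * z * y * x * S.E false a)
    {x y z : R} (hx : x ∈ S.filt true k) (hy : y ∈ S.diag false) (hz : z ∈ S.diag true) :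
    S.E false a * x * y * z * S.E false a = S.E false a * z * y * x * S.E false a := by
  obtain ⟨y', hy', h'⟩ := ha.exists_replace k hy
  rw [(h' x hx).1, h y' hy' x (S.filt_le_diag _ _ hx) z hz, mul_assoc _ y, mul_assoc _ (y * x),
    (h' x hx).2]
  simp only [mul_assoc]

/-- For `y` of degree `k + 1` the defect `Φ i j` of the swap of `E true i` and `E true j` is
antisymmetric and banded of width `k + 1`. Its moments of order at most `k` vanish by the induction
hypothesis, which forces each column to vanish in turn. -/
theorem IsBase.swap_filt (ha : S.IsBase a) (k : ℕ) :
    ∀ y ∈ S.filt false k, ∀ x ∈ S.diag true, ∀ z ∈ S.diag true,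
      S.E false a * x * y * z * S.E false a = S.E false a * z * y * x * S.E false a := by
  induction k with
  | zero =>
    intro y hy x hx z hz
    rw [filt_zero, Submodule.mem_one] at hy
    obtain ⟨c, rfl⟩ := hy
    rw [mul_assoc _ (algebraMap K R c), mul_assoc _ (algebraMap K R c), Algebra.commutes,
      Algebra.commutes]
    simp only [← mul_assoc]
    rw [mul_assoc _ x z, S.diag_comm true hx hz, ← mul_assoc]
  | succ k ih =>
    intro y hy x hx z hz
    set Φ : ℕ → ℕ → R := fun i j =>
      S.E false a * S.E true i * y * S.E true j * S.E false a -
        S.E false a * S.E true j * y * S.E true i * S.E false a with hΦ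
    have hanti : ∀ i j, Φ i j = - Φ j i := fun i j => by simp [hΦ]
    have hband : ∀ i j, (i + (k + 1) < j ∨ j + (k + 1) < i) → Φ i j = 0 := by
      intro i j hij
      simp only [hΦ]
      rw [mul_assoc (S.E false a), mul_assoc (S.E false a), mul_assoc (S.E false a) (S.E true j),
        mul_assoc (S.E false a) (S.E true j * y),
        S.E_mul_filt_mul_E (b := true) hy hij, S.E_mul_filt_mul_E (b := true) hy hij.symm]
      simp
    -- The `m`-th moment is the defect of swapping `A true ^ m` with `E true j`, and `m ≤ k`.
    have hsum : ∀ j, ∀ m < k + 1,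
        ∑ i ∈ range (S.size true), S.θ true i ^ m • Φ i j = 0 := by
      intro j m hm
      have h1 := ha.swap_of_swap_filt ih (S.pow_mem_filt true (Nat.lt_succ_iff.1 hm))
        (S.filt_le_diag _ _ hy) (S.E_mem_diag true j)
      rw [← sub_eq_zero, pow_eq_sum] at h1
      simp only [Finset.mul_sum, Finset.sum_mul, mul_smul_comm, smul_mul_assoc] at h1
      rw [← Finset.sum_sub_distrib] at h1
      simpa only [hΦ, smul_sub] using h1
    have hzero : ∀ j, ∀ i ∈ range (S.size true), Φ i j = 0 := by
      intro j
      induction j using Nat.strong_induction_on with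
      | _ j ihj =>
        -- Earlier columns and antisymmetry remove `i < j`, and the band bounds `i` from above: `k +
        -- 1` unknowns remain against `k + 1` moments.
        refine eq_zero_of_sum_pow_smul_eq_zero (S.injOn true) (fun i => Φ i j)
          (s := Finset.Icc (j + 1) (j + (k + 1))) ?_ (k + 1) (by simp) (hsum j)
        intro i hi his
        rcases lt_trichotomy i j with hij | hij | hij
        · rcases lt_or_ge j (S.size true) with hj | hj
          · change Φ i j = 0
            rw [hanti, ihj i hij j (mem_range.2 hj), neg_zero]
          · simp [hΦ, S.E_eq_zero hj]
        · subst hij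
          simp [hΦ]
        · refine hband i j (Or.inr ?_)
          simp only [Finset.mem_Icc] at his
          omega
    have hE : ∀ i j, S.E false a * S.E true i * y * S.E true j * S.E false a =
        S.E false a * S.E true j * y * S.E true i * S.E false a := by
      intro i j
      rcases lt_or_ge i (S.size true) with hi | hi
      · exact sub_eq_zero.1 (hzero j i (mem_range.2 hi))
      · simp [S.E_eq_zero hi]
    induction hx using Submodule.span_induction with
    | mem x hx =>
      obtain ⟨i, rfl⟩ := hx
      induction hz using Submodule.span_induction with
      | mem z hz =>
        obtain ⟨j, rfl⟩ := hz
        exact hE i j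
      | zero => simp
      | add x y _ _ h1 h2 => simp only [mul_add, add_mul, h1, h2]
      | smul a x _ h => simp only [mul_smul_comm, smul_mul_assoc, h]
    | zero => simp
    | add x y _ _ h1 h2 => simp only [mul_add, add_mul, h1, h2]
    | smul a x _ h => simp only [mul_smul_comm, smul_mul_assoc, h]

/-- This is the swap with the middle factor `y = E false a`, itself a polynomial in `A false`. -/
theorem IsBase.corner_comm (ha : S.IsBase a) {x z : R} (hx : x ∈ S.diag true)
    (hz : z ∈ S.diag true) :
    (S.E false a * x * S.E false a) * (S.E false a * z * S.E false a) =
      (S.E false a * z * S.E false a) * (S.E false a * x * S.E false a) := by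
  have h := ha.swap_filt (S.size false) _ (S.diag_le_filt _ (S.E_mem_diag false a)) x hx z hz
  have key : ∀ u v : R, (S.E false a * u * S.E false a) * (S.E false a * v * S.E false a) =
      S.E false a * u * S.E false a * v * S.E false a := by
    intro u v
    rw [mul_assoc (S.E false a) v, ← mul_assoc, mul_assoc _ (S.E false a) (S.E false a),
      S.mul_self, ← mul_assoc]
  rw [key, key, h]

/-! ### Lowering the degree of a factor inside a word. -/

variable (S)

/-- Reduction of a local minimum `m + 1` in a product of polynomials in `A true` and `A false`. -/
theorem diag_mul_filt_mul_diag_le (b : Bool) (m : ℕ) :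
    S.diag b * S.filt (!b) (m + 1) * S.diag b ≤
      S.diag b * S.filt (!b) (m + 1) * S.filt b m ⊔
        S.filt b (m + 1) * S.filt (!b) (m + 1) * S.diag b := by
  set T := S.diag b * S.filt (!b) (m + 1) * S.filt b m ⊔
        S.filt b (m + 1) * S.filt (!b) (m + 1) * S.diag b with hT
  -- Modulo `T` the array `E b i * y * E b j` is banded of width `m + 1`. Its columns satisfy `m +
  -- 2` moment equations and its rows `m + 1`. Column `t` and then row `t` are eliminated, for
  -- increasing `t`.
  have key : ∀ y ∈ S.filt (!b) (m + 1), ∀ t, (∀ i, S.E b i * y * S.E b t ∈ T) ∧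
      (∀ j, S.E b t * y * S.E b j ∈ T) := by
    intro y hy
    have hcol : ∀ j, ∀ k < m + 2,
        ∑ i ∈ range (S.size b), S.θ b i ^ k • T.mkQ (S.E b i * y * S.E b j) = 0 := by
      intro j k hk
      have h1 : S.A b ^ k * y * S.E b j ∈ T :=
        (le_sup_right : _ ≤ T) (Submodule.mul_mem_mul (Submodule.mul_mem_mul
          (S.pow_mem_filt b (by omega)) hy) (S.E_mem_diag b j))
      rw [← Submodule.Quotient.mk_eq_zero, ← Submodule.mkQ_apply, pow_eq_sum] at h1
      simpa only [Finset.mul_sum, Finset.sum_mul, mul_smul_comm, smul_mul_assoc, map_sum,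
        map_smul] using h1
    have hrow : ∀ i, ∀ k < m + 1,
        ∑ j ∈ range (S.size b), S.θ b j ^ k • T.mkQ (S.E b i * y * S.E b j) = 0 := by
      intro i k hk
      have h1 : S.E b i * y * S.A b ^ k ∈ T :=
        (le_sup_left : _ ≤ T) (Submodule.mul_mem_mul (Submodule.mul_mem_mul
          (S.E_mem_diag b i) hy) (S.pow_mem_filt b (by omega)))
      rw [← Submodule.Quotient.mk_eq_zero, ← Submodule.mkQ_apply, pow_eq_sum] at h1
      simpa only [Finset.mul_sum, Finset.sum_mul, mul_smul_comm, smul_mul_assoc, map_sum,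
        map_smul] using h1
    intro t
    induction t using Nat.strong_induction_on with
    | _ t ih =>
      have c1 : ∀ i, S.E b i * y * S.E b t ∈ T := by
        intro i
        rcases lt_or_ge i (S.size b) with hi | hi
        · rw [← Submodule.Quotient.mk_eq_zero, ← Submodule.mkQ_apply]
          -- Rows before `t` are already eliminated, so column `t` has the `m + 2` unknowns `t, …, t
          -- + m + 1`.
          refine eq_zero_of_sum_pow_smul_eq_zero (S.injOn b)
            (fun i => T.mkQ (S.E b i * y * S.E b t))
            (s := Finset.Icc t (t + (m + 1))) ?_ (m + 2) (by simp; omega) (hcol t) i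
            (mem_range.2 hi)
          intro i _ his
          rcases lt_or_ge i t with hit | hit
          · simpa only [Submodule.mkQ_apply, Submodule.Quotient.mk_eq_zero] using (ih i hit).2 t
          · simp only [Finset.mem_Icc] at his
            rw [S.E_mul_filt_mul_E hy (by omega), map_zero]
        · simp [S.E_eq_zero hi]
      refine ⟨c1, fun j => ?_⟩
      rcases lt_or_ge j (S.size b) with hj | hj
      · rw [← Submodule.Quotient.mk_eq_zero, ← Submodule.mkQ_apply]
        -- The diagonal entry is now eliminated as well, so row `t` has only `m + 1` unknowns. This
        -- asymmetry is why degree `m` suffices in the first summand of `T`.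
        refine eq_zero_of_sum_pow_smul_eq_zero (S.injOn b)
          (fun j => T.mkQ (S.E b t * y * S.E b j))
          (s := Finset.Icc (t + 1) (t + (m + 1))) ?_ (m + 1) (by simp) (hrow t) j
          (mem_range.2 hj)
        intro i _ his
        rcases lt_trichotomy i t with hit | hit | hit
        · simpa only [Submodule.mkQ_apply, Submodule.Quotient.mk_eq_zero] using (ih i hit).1 t
        · subst hit
          simpa only [Submodule.mkQ_apply, Submodule.Quotient.mk_eq_zero] using c1 i
        · simp only [Finset.mem_Icc] at his
          rw [S.E_mul_filt_mul_E hy (by omega), map_zero]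
      · simp [S.E_eq_zero hj]
  rw [Submodule.mul_le]
  intro u hu z hz
  induction hu using Submodule.mul_induction_on' with
  | add x y _ _ h1 h2 => rw [add_mul]; exact T.add_mem h1 h2
  | mem_mul_mem x hx y hy =>
    induction hx using Submodule.span_induction with
    | mem x hx =>
      obtain ⟨i, rfl⟩ := hx
      induction hz using Submodule.span_induction with
      | mem z hz =>
        obtain ⟨j, rfl⟩ := hz
        exact (key y hy i).2 j
      | zero => simp
      | add x y _ _ h1 h2 => rw [mul_add]; exact T.add_mem h1 h2
      | smul a x _ h => rw [mul_smul_comm]; exact T.smul_mem _ h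
    | zero => simp
    | add x y _ _ h1 h2 => rw [add_mul, add_mul]; exact T.add_mem h1 h2
    | smul a x _ h => rw [smul_mul_assoc, smul_mul_assoc]; exact T.smul_mem _ h

end TridiagonalSystem

/-! ### Alternating words and the induction on their length. -/

namespace TridiagonalSystem

variable {K R : Type*} [Field K] [Ring R] [Algebra K R] (S : TridiagonalSystem K R)

/-- The span of the products `e * x₀ * x₁ * ⋯ * xₖ₋₁` with factors alternatingly from `diag true`
and `diag false`, where `e = E false a`. -/
def leftWords (a : ℕ) : ℕ → Submodule K R
  | 0 => Submodule.span K {S.E false a}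
  | k + 1 => leftWords a k * S.diag (!k.bodd)

/-- The span of the products `xₖ₋₁ * ⋯ * x₁ * x₀ * e` with factors alternatingly from `diag true`
and `diag false`, where `e = E false a`. -/
def rightWords (a : ℕ) : ℕ → Submodule K R
  | 0 => Submodule.span K {S.E false a}
  | k + 1 => S.diag (!k.bodd) * rightWords a k

/-- The elements that are fixed by `τ` and commute with all `e * x * e` for `x ∈ diag true`, where
`e = E false a`. -/
def fixedCentralizer (τ : R →ₗ[K] R) (a : ℕ) : Submodule K R where
  carrier := {c | τ c = c ∧ ∀ x ∈ S.diag true,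
    c * (S.E false a * x * S.E false a) = (S.E false a * x * S.E false a) * c}
  add_mem' := fun hx hy => ⟨by rw [map_add, hx.1, hy.1], fun z hz => by
    rw [add_mul, mul_add, hx.2 z hz, hy.2 z hz]⟩
  zero_mem' := by simp
  smul_mem' := fun c x hx => ⟨by rw [map_smul, hx.1], fun z hz => by
    rw [smul_mul_assoc, mul_smul_comm, hx.2 z hz]⟩

theorem leftWords_succ (a k : ℕ) :
    S.leftWords a (k + 1) = S.leftWords a k * S.diag (!k.bodd) := rfl

theorem rightWords_succ (a k : ℕ) :
    S.rightWords a (k + 1) = S.diag (!k.bodd) * S.rightWords a k := rfl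

/-- The point at which a word is cut is immaterial: for an odd number of factors, the types counted
from the left and from the right agree. -/
theorem leftWords_mul_rightWords (a n : ℕ) (p q : ℕ) (h : p + q = 2 * n + 1) :
    S.leftWords a p * S.rightWords a q = S.leftWords a (2 * n + 1) * S.rightWords a 0 := by
  induction q generalizing p with
  | zero => rw [← h, add_zero]
  | succ q ih =>
    rw [← ih (p + 1) (by omega), rightWords, leftWords, ← mul_assoc]
    have : p.bodd = q.bodd := by
      have h1 : (p + q).bodd = false := by
        rw [show p + q = 2 * n by omega, Nat.bodd_mul]; simp
      rw [Nat.bodd_add] at h1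
      revert h1
      cases p.bodd <;> cases q.bodd <;> simp
    rw [this]

variable {S} {a : ℕ} {τ : R →ₗ[K] R}

theorem map_diag (hτ : ∀ b i, τ (S.E b i) = S.E b i) {b : Bool} {x : R} (hx : x ∈ S.diag b) :
    τ x = x := by
  induction hx using Submodule.span_induction with
  | mem x hx => obtain ⟨i, rfl⟩ := hx; exact hτ b i
  | zero => simp
  | add x y _ _ h1 h2 => rw [map_add, h1, h2]
  | smul a x _ h => rw [map_smul, h]

theorem IsBase.corner_le_fixedCentralizer (ha : S.IsBase a) (hτ : ∀ b i, τ (S.E b i) = S.E b i)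
    (hmul : ∀ x y, τ (x * y) = τ y * τ x) {x : R} (hx : x ∈ S.diag true) :
    S.E false a * x * S.E false a ∈ S.fixedCentralizer τ a :=
  ⟨by rw [hmul, hmul, hτ, map_diag hτ hx, mul_assoc], fun _ hz => ha.corner_comm hx hz⟩

/-- Here both conditions in `fixedCentralizer` are needed: `τ` reverses the product of two fixed
elements, and the centralizing property of `c` restores the order. -/
theorem corner_mul_mem (hτ : ∀ b i, τ (S.E b i) = S.E b i)
    (hmul : ∀ x y, τ (x * y) = τ y * τ x) (ha : S.IsBase a)
    {x c : R} (hx : x ∈ S.diag true) (hc : c ∈ S.fixedCentralizer τ a) :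
    S.E false a * x * S.E false a * c ∈ S.fixedCentralizer τ a := by
  have h := ha.corner_le_fixedCentralizer hτ hmul hx
  refine ⟨by rw [hmul, h.1, hc.1, hc.2 x hx], fun z hz => ?_⟩
  rw [mul_assoc, hc.2 z hz, ← mul_assoc, h.2 z hz, mul_assoc]

theorem singleton_mul_singleton (a : ℕ) :
    Submodule.span K {S.E false a} * Submodule.span K {S.E false a} =
      Submodule.span K {S.E false a} := by
  rw [Submodule.span_mul_span, Set.singleton_mul_singleton, S.mul_self]

/-- Boundary case at the right end of a word: `filt true m` next to `e` lowers the degree of its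
neighbour to `m`. -/
theorem IsBase.diag_mul_filt_le (ha : S.IsBase a) (m : ℕ) :
    S.diag false * S.filt true m * S.rightWords a 0 ≤
      S.filt false m * S.filt true m * S.rightWords a 0 := by
  intro w hw
  obtain ⟨u, hu, rfl⟩ := Submodule.mem_mul_span_singleton.1 hw
  refine Submodule.mem_mul_span_singleton.2 ?_
  clear hw
  induction hu using Submodule.mul_induction_on' with
  | add x y _ _ h1 h2 =>
    obtain ⟨u, hu, hu'⟩ := h1
    obtain ⟨v, hv, hv'⟩ := h2
    exact ⟨u + v, Submodule.add_mem _ hu hv, by rw [add_mul, hu', hv', add_mul]⟩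
  | mem_mul_mem y hy x hx =>
    obtain ⟨y', hy', h⟩ := ha.exists_replace m hy
    exact ⟨y' * x, Submodule.mul_mem_mul hy' hx, (h x hx).2.symm⟩

/-- Boundary case at the left end, where the degree exceeds the target by one. The price is the
second summand, in which an element `e * x * e` splits off. -/
theorem IsBase.filt_mul_diag_le (ha : S.IsBase a) (m : ℕ) :
    S.leftWords a 0 * S.filt true (m + 1) * S.diag false ≤
      S.leftWords a 0 * S.filt true (m + 1) * S.filt false m ⊔
        S.leftWords a 0 * S.filt true (m + 1) * S.leftWords a 0 := by
  rw [Submodule.mul_le]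
  intro u hu y hy
  obtain ⟨x, hx, rfl⟩ := Submodule.mem_span_singleton_mul.1 hu
  obtain ⟨y', hy', c, h⟩ := ha.exists_replace_succ m hy
  rw [h x hx]
  have he : S.E false a ∈ S.leftWords a 0 := Submodule.mem_span_singleton_self _
  exact Submodule.add_mem_sup (Submodule.mul_mem_mul (Submodule.mul_mem_mul he hx) hy')
    (Submodule.smul_mem _ _ (Submodule.mul_mem_mul (Submodule.mul_mem_mul he hx) he))

theorem IsBase.corner_mul_words_le (ha : S.IsBase a) (hτ : ∀ b i, τ (S.E b i) = S.E b i)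
    (hmul : ∀ x y, τ (x * y) = τ y * τ x) {W : Submodule K R} (hW : W ≤ S.fixedCentralizer τ a) :
    S.leftWords a 0 * S.diag true * S.leftWords a 0 * W ≤ S.fixedCentralizer τ a := by
  rw [Submodule.mul_le]
  intro u hu w hw
  obtain ⟨v, hv, rfl⟩ := Submodule.mem_mul_span_singleton.1 hu
  obtain ⟨x, hx, rfl⟩ := Submodule.mem_span_singleton_mul.1 hv
  exact corner_mul_mem hτ hmul ha hx (hW hw)

/-- A word with `2 * n + 3` factors, one of which has degree at most `m`, is treated by induction on
`m` and then on the position `p` of that factor. -/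
theorem IsBase.words_filt_le (ha : S.IsBase a) (hτ : ∀ b i, τ (S.E b i) = S.E b i)
    (hmul : ∀ x y, τ (x * y) = τ y * τ x) (n : ℕ)
    (ih : S.leftWords a (2 * n + 1) * S.rightWords a 0 ≤ S.fixedCentralizer τ a) (m : ℕ) :
    ∀ p q, p + q = 2 * n →
      S.leftWords a (p + 1) * S.filt p.bodd m * S.rightWords a (q + 1) ≤
        S.fixedCentralizer τ a := by
  have parity : ∀ p q, p + q = 2 * n → q.bodd = p.bodd := by
    intro p q h
    have h1 : (p + q).bodd = false := by rw [h, Nat.bodd_mul]; simp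
    rw [Nat.bodd_add] at h1
    revert h1
    cases p.bodd <;> cases q.bodd <;> simp
  induction m with
  | zero =>
    intro p q h
    -- A scalar factor disappears and its two neighbours, of the same type, merge: two factors
    -- fewer.
    rw [filt_zero, mul_one, leftWords, rightWords, parity p q h, mul_assoc, ← mul_assoc (S.diag _),
      diag_mul_diag, ← mul_assoc]
    have := S.leftWords_mul_rightWords a n (p + 1) q (by omega)
    rw [leftWords] at this
    rwa [this]
  | succ m ihm =>
    intro p
    induction p using Nat.strong_induction_on with
    | _ p ihp =>
      intro q h
      have hq := parity p q h
      set b := !p.bodd with hb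
      have hpb : p.bodd = !b := by simp [hb]
      have hsplit : S.leftWords a (p + 1) * S.filt p.bodd (m + 1) * S.rightWords a (q + 1) =
          S.leftWords a p * (S.diag b * S.filt (!b) (m + 1) * S.diag b) * S.rightWords a q := by
        rw [leftWords, rightWords, hq, ← hb, hpb]
        simp only [mul_assoc]
      rw [hsplit]
      refine (mul_le_mul_left (mul_le_mul_right (S.diag_mul_filt_mul_diag_le b m) _) _).trans ?_
      rw [Submodule.mul_sup, Submodule.sup_mul, sup_le_iff]
      constructor
      · have h1 : S.leftWords a p * (S.diag b * S.filt (!b) (m + 1) * S.filt b m) *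
            S.rightWords a q ≤ S.leftWords a (p + 1) * (S.diag (!b) * S.filt b m) *
              S.rightWords a q := by
          rw [leftWords, ← hb]
          have := S.filt_le_diag (!b) (m + 1)
          simp only [mul_assoc]
          gcongr
        refine h1.trans ?_
        -- First summand: the right neighbour now has degree `m`. If there is a further factor, the
        -- hypothesis for `m` applies at position `p + 1`. Otherwise the neighbour stands next to
        -- the final `e` and lowers the original factor to degree `m`.
        rcases q with _ | q
        · have hpf : p.bodd = false := by simpa using hq.symm
          have hbt : b = true := by simp [hb, hpf]
          have h2 := ha.diag_mul_filt_le m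
          rw [hbt, mul_assoc]
          refine (mul_le_mul_right h2 _).trans ?_
          have h3 := ihm p 0 h
          rw [hpf] at h3
          refine le_trans ?_ h3
          rw [rightWords_succ]
          have := S.filt_le_diag true m
          simp only [mul_assoc, Nat.bodd_zero, Bool.not_false]
          gcongr
        · have h3 := ihm (p + 1) q (by omega)
          rw [Nat.bodd_succ, ← hb] at h3
          rw [leftWords, Nat.bodd_succ, ← hb] at h3
          rwa [← mul_assoc]
      -- Second summand: the left neighbour now has degree `m + 1`, so the hypothesis for a smaller
      -- position applies unless that neighbour stands next to the initial `e`.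
      · rcases p with _ | p
        · have hbt : b = true := by simp [hb]
          rw [hbt] at hb ⊢
          have hq1 : S.diag true * S.rightWords a q = S.rightWords a (q + 1) := by
            rw [rightWords, hq]; simp
          have h1 : S.leftWords a 0 * (S.filt true (m + 1) * S.filt (!true) (m + 1) * S.diag true) *
            S.rightWords a q ≤ (S.leftWords a 0 * S.filt true (m + 1) * S.diag false) *
              S.rightWords a (q + 1) := by
            rw [← hq1]
            have := S.filt_le_diag false (m + 1)
            simp only [mul_assoc, Bool.not_true]
            gcongr
          refine h1.trans ((mul_le_mul_left (ha.filt_mul_diag_le m) _).trans ?_)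
          have hD := S.filt_le_diag true (m + 1)
          rw [Submodule.sup_mul, sup_le_iff]
          constructor
          · refine le_trans ?_ (ihm 0 q h)
            rw [leftWords_succ]
            simp only [Nat.bodd_zero, Bool.not_false]
            gcongr
          -- The split-off term is `e * x * e` times a word with `2 * n + 1` factors.
          · have h4 : S.leftWords a 0 * S.rightWords a (q + 1) ≤ S.fixedCentralizer τ a := by
              rw [S.leftWords_mul_rightWords a n 0 (q + 1) (by omega)]
              exact ih
            refine le_trans ?_ (ha.corner_mul_words_le hτ hmul h4)
            have he : S.leftWords a 0 = S.leftWords a 0 * S.leftWords a 0 :=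
              (singleton_mul_singleton a).symm
            rw [← mul_assoc _ (S.leftWords a 0), mul_assoc _ (S.leftWords a 0) (S.leftWords a 0),
              ← he]
            gcongr
        · have h3 := ihp p (by omega) (q + 1) (by omega)
          have hbp : b = p.bodd := by simp [hb]
          rw [← hbp] at h3
          refine le_trans ?_ h3
          rw [rightWords_succ, rightWords_succ, Nat.bodd_succ, hq, hpb]
          have := S.filt_le_diag (!b) (m + 1)
          simp only [mul_assoc, Bool.not_not]
          gcongr

theorem IsBase.words_le (ha : S.IsBase a) (hτ : ∀ b i, τ (S.E b i) = S.E b i)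
    (hmul : ∀ x y, τ (x * y) = τ y * τ x) (n : ℕ) :
    S.leftWords a (2 * n + 1) * S.rightWords a 0 ≤ S.fixedCentralizer τ a := by
  induction n with
  | zero =>
    intro w hw
    obtain ⟨v, hv, rfl⟩ := Submodule.mem_mul_span_singleton.1 hw
    obtain ⟨x, hx, rfl⟩ := Submodule.mem_span_singleton_mul.1 hv
    exact ha.corner_le_fixedCentralizer hτ hmul hx
  | succ n ih =>
    rw [← S.leftWords_mul_rightWords a (n + 1) 1 (2 * n + 2) (by omega), rightWords, ← mul_assoc]
    -- Any factor has some finite degree; the second one, in `diag false`, is used, with bound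
    -- `S.size false`.
    refine le_trans ?_ (ha.words_filt_le hτ hmul n ih (S.size false) 0 (2 * n) (by omega))
    have h : (2 * n + 1).bodd = true := by simp [Nat.bodd_mul]
    have := S.diag_le_filt false
    rw [h]
    simp only [Bool.not_true, zero_add, Nat.bodd_zero]
    gcongr

theorem exists_mem_pow_of_mem_adjoin {x : R} (hx : x ∈ Algebra.adjoin K (Set.range S.A)) :
    ∃ n, x ∈ (S.diag true * S.diag false) ^ n := by
  have h1 : (1 : R) ∈ S.diag true * S.diag false := by
    simpa using Submodule.mul_mem_mul (S.one_mem_diag true) (S.one_mem_diag false)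
  have hmono : ∀ m n, m ≤ n → (S.diag true * S.diag false) ^ m ≤ (S.diag true * S.diag false) ^ n :=
    fun m n h => pow_le_pow_right₀ (Submodule.one_le.2 h1) h
  induction hx using Algebra.adjoin_induction with
  | mem x hx =>
    obtain ⟨b, rfl⟩ := hx
    refine ⟨1, ?_⟩
    rw [pow_one]
    cases b
    · simpa using Submodule.mul_mem_mul (S.one_mem_diag true) (S.A_mem_diag false)
    · simpa using Submodule.mul_mem_mul (S.A_mem_diag true) (S.one_mem_diag false)
  | algebraMap r => exact ⟨0, by rw [pow_zero]; exact Submodule.algebraMap_mem r⟩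
  | add x y _ _ hx hy =>
    obtain ⟨m, hm⟩ := hx
    obtain ⟨n, hn⟩ := hy
    exact ⟨max m n, Submodule.add_mem _ (hmono _ _ (le_max_left _ _) hm)
      (hmono _ _ (le_max_right _ _) hn)⟩
  | mul x y _ _ hx hy =>
    obtain ⟨m, hm⟩ := hx
    obtain ⟨n, hn⟩ := hy
    exact ⟨m + n, by rw [pow_add]; exact Submodule.mul_mem_mul hm hn⟩

theorem leftWords_two_mul (n : ℕ) :
    S.leftWords a (2 * n) = S.leftWords a 0 * (S.diag true * S.diag false) ^ n := by
  induction n with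
  | zero => simp
  | succ n ih =>
    have h : (2 * n).bodd = false := by simp [Nat.bodd_mul]
    rw [show 2 * (n + 1) = 2 * n + 1 + 1 by ring, leftWords_succ, leftWords_succ, ih, Nat.bodd_succ, h,
      pow_succ]
    simp only [mul_assoc, Bool.not_false, Bool.not_true]

/-- If `e` is the first idempotent of `A false`, then the corner at `e` of the algebra generated by
`A true` and `A false` is fixed pointwise by every antiautomorphism that fixes all idempotents. -/
theorem IsBase.map_corner (ha : S.IsBase a) (hτ : ∀ b i, τ (S.E b i) = S.E b i)
    (hmul : ∀ x y, τ (x * y) = τ y * τ x) {x : R} (hx : x ∈ Algebra.adjoin K (Set.range S.A)) :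
    τ (S.E false a * x * S.E false a) = S.E false a * x * S.E false a := by
  obtain ⟨n, hn⟩ := exists_mem_pow_of_mem_adjoin hx
  refine (ha.words_le hτ hmul n ?_).1
  refine Submodule.mul_mem_mul ?_ (Submodule.mem_span_singleton_self _)
  rw [leftWords, leftWords_two_mul, ← mul_one (S.E false a * x)]
  exact Submodule.mul_mem_mul (Submodule.mul_mem_mul (Submodule.mem_span_singleton_self _) hn)
    (S.one_mem_diag _)

end TridiagonalSystem

/-! ### Finite tridiagonal pairs, duality and reversal. -/

/-- `E true` and `E false` are families of pairwise orthogonal idempotents with sum `1` such that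
each of the elements `∑ i, θ b i • E b i` acts on the other family in a tridiagonal fashion. -/
structure IsTridiagonalPair {K R : Type*} [Field K] [Ring R] [Algebra K R] {n : ℕ}
    (E : Bool → Fin n → R) (θ : Bool → Fin n → K) : Prop where
  mul_self : ∀ b i, E b i * E b i = E b i
  mul_of_ne : ∀ b i j, i ≠ j → E b i * E b j = 0
  sum_eq_one : ∀ b, ∑ i, E b i = 1
  injective : ∀ b, Function.Injective (θ b)
  tridiagonal : ∀ b (i j : Fin n), ((i : ℕ) + 1 < j ∨ (j : ℕ) + 1 < i) →
    E b i * (∑ l, θ (!b) l • E (!b) l) * E b j = 0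

namespace IsTridiagonalPair

variable {K R : Type*} [Field K] [Ring R] [Algebra K R] {n : ℕ}

section

variable {E : Bool → Fin n → R} {θ : Bool → Fin n → K}

theorem dual (h : IsTridiagonalPair E θ) :
    IsTridiagonalPair (fun b => E (!b)) (fun b => θ (!b)) where
  mul_self _ := h.mul_self _
  mul_of_ne _ := h.mul_of_ne _
  sum_eq_one _ := h.sum_eq_one _
  injective _ := h.injective _
  tridiagonal _ := h.tridiagonal _

/-- Reversal of the order of `E false`. -/
theorem rev (h : IsTridiagonalPair E θ) :
    IsTridiagonalPair (fun b i => E b (cond b i i.rev)) (fun b i => θ b (cond b i i.rev)) where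
  mul_self b i := h.mul_self _ _
  mul_of_ne b i j hij := h.mul_of_ne _ _ _ (by cases b <;> simpa using hij)
  sum_eq_one b := by
    cases b
    · rw [← h.sum_eq_one false]
      exact Equiv.sum_comp Fin.revPerm (E false)
    · exact h.sum_eq_one true
  injective b i j hij := by cases b <;> simpa using h.injective _ hij
  tridiagonal b i j hij := by
    cases b
    · refine h.tridiagonal false _ _ ?_
      simp only [cond_false, Fin.val_rev]
      omega
    · have h1 := h.tridiagonal true i j hij
      rwa [← Equiv.sum_comp Fin.revPerm] at h1

/-- The system with index set `ℕ`, obtained by continuing with zero. -/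
def toSystem (h : IsTridiagonalPair E θ) : TridiagonalSystem K R where
  E b i := if hi : i < n then E b ⟨i, hi⟩ else 0
  θ b i := if hi : i < n then θ b ⟨i, hi⟩ else 0
  size _ := n
  mul_self b i := by split_ifs <;> simp [h.mul_self]
  mul_of_ne b i j hij := by split_ifs <;> simp [h.mul_of_ne, hij]
  sum_eq_one b := by
    rw [Finset.sum_range, ← h.sum_eq_one b]
    simp
  injOn b i hi j hj hij := by
    have hi' : i < n := by simpa using hi
    have hj' : j < n := by simpa using hj
    simp only [hi', hj', dif_pos] at hij
    simpa using h.injective b hij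
  tridiagonal b i j hij := by
    by_cases hi : i < n
    swap
    · simp [hi]
    by_cases hj : j < n
    swap
    · simp [hj]
    rw [Finset.sum_range]
    simpa [hi, hj] using h.tridiagonal b ⟨i, hi⟩ ⟨j, hj⟩ hij

theorem toSystem_E (h : IsTridiagonalPair E θ) (b : Bool) (i : Fin n) :
    h.toSystem.E b i = E b i := by simp [toSystem]

theorem toSystem_A (h : IsTridiagonalPair E θ) (b : Bool) :
    h.toSystem.A b = ∑ i, θ b i • E b i := by
  simp [TridiagonalSystem.A, toSystem, Finset.sum_range]

theorem map_corner_of_isBase (h : IsTridiagonalPair E θ) (a : Fin n)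
    (ha : ∀ i j, i < a → a ≤ j →
      E false i * (∑ l, θ true l • E true l) * E false j = 0 ∧
      E false j * (∑ l, θ true l • E true l) * E false i = 0)
    {τ : R →ₗ[K] R} (hτ : ∀ b i, τ (E b i) = E b i)
    (hmul : ∀ x y, τ (x * y) = τ y * τ x) {x : R}
    (hx : x ∈ Algebra.adjoin K (Set.range fun b => ∑ i, θ b i • E b i)) :
    τ (E false a * x * E false a) = E false a * x * E false a := by
  have hbase : h.toSystem.IsBase a := by
    intro i j hi hj
    rw [h.toSystem_A]
    have hin : i < n := hi.trans a.2
    by_cases hjn : j < n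
    · exact h.toSystem_E false ⟨i, hin⟩ ▸ h.toSystem_E false ⟨j, hjn⟩ ▸ ha ⟨i, hin⟩ ⟨j, hjn⟩ hi hj
    · rw [h.toSystem.E_eq_zero (not_lt.1 hjn)]
      simp
  have hτ' : ∀ b i, τ (h.toSystem.E b i) = h.toSystem.E b i := by
    intro b i
    by_cases hi : i < n
    · rw [h.toSystem_E b ⟨i, hi⟩, hτ]
    · rw [h.toSystem.E_eq_zero (not_lt.1 hi), map_zero]
  have := hbase.map_corner hτ' hmul (x := x) (by rwa [funext h.toSystem_A])
  rwa [h.toSystem_E] at this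

end

variable {E : Bool → Fin (n + 1) → R} {θ : Bool → Fin (n + 1) → K}

theorem map_corner_zero (h : IsTridiagonalPair E θ) {τ : R →ₗ[K] R}
    (hτ : ∀ b i, τ (E b i) = E b i) (hmul : ∀ x y, τ (x * y) = τ y * τ x) {x : R}
    (hx : x ∈ Algebra.adjoin K (Set.range fun b => ∑ i, θ b i • E b i)) :
    τ (E false 0 * x * E false 0) = E false 0 * x * E false 0 :=
  h.map_corner_of_isBase 0 (fun i _ hi => absurd hi (Fin.not_lt_zero i)) hτ hmul hx

theorem map_corner_last (h : IsTridiagonalPair E θ) {τ : R →ₗ[K] R}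
    (hτ : ∀ b i, τ (E b i) = E b i) (hmul : ∀ x y, τ (x * y) = τ y * τ x) {x : R}
    (hx : x ∈ Algebra.adjoin K (Set.range fun b => ∑ i, θ b i • E b i)) :
    τ (E false (Fin.last n) * x * E false (Fin.last n)) =
      E false (Fin.last n) * x * E false (Fin.last n) := by
  have h1 : (fun b => ∑ i, θ b (cond b i i.rev) • E b (cond b i i.rev)) =
      fun b => ∑ i, θ b i • E b i := by
    funext b
    cases b
    · exact Equiv.sum_comp Fin.revPerm fun i => θ false i • E false i
    · rfl
  have := h.rev.map_corner_zero (fun b i => hτ b _) hmul (x := x) (by rwa [h1])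
  simpa using this

/-! ### Splitting off a central idempotent to reach the index `1`. -/

variable {P : R}

/-- If the central idempotent `P` absorbs `E true 0` and `E false 0`, then the idempotents
`P, (1 - P) * E b 1, …, (1 - P) * E b n` form a tridiagonal pair again. -/
theorem deflate (h : IsTridiagonalPair E θ) (hP : P * P = P) (hc : ∀ b i, Commute P (E b i))
    (h0 : ∀ b, P * E b 0 = E b 0) :
    IsTridiagonalPair (fun b i => if i = 0 then P else (1 - P) * E b i) θ where
  mul_self b i := by
    split_ifs
    · exact hP
    · have hQ : (1 - P) * (1 - P) = 1 - P := by simp [mul_sub, sub_mul, hP]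
      have := ((Commute.one_left (E b i)).sub_left (hc b i)).eq
      rw [mul_assoc, ← mul_assoc (E b i), ← this, mul_assoc, h.mul_self, ← mul_assoc, hQ]
  mul_of_ne b i j hij := by
    have hPQ : P * (1 - P) = 0 := by simp [mul_sub, hP]
    have hQP : (1 - P) * P = 0 := by simp [sub_mul, hP]
    have := ((Commute.one_left (E b i)).sub_left (hc b i)).eq
    split_ifs with hi hj hj
    · exact absurd (hi.trans hj.symm) hij
    · rw [← mul_assoc, hPQ, zero_mul]
    · rw [mul_assoc, ← (hc b i).eq, ← mul_assoc, hQP, zero_mul]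
    · rw [mul_assoc, ← mul_assoc (E b i), ← this, mul_assoc, h.mul_of_ne b i j hij]
      simp
  sum_eq_one b := by
    have h1 := h.sum_eq_one b
    rw [Fin.sum_univ_succ] at h1 ⊢
    simp only [if_true, Fin.succ_ne_zero, if_false]
    -- As `(1 - P) * E b 0 = 0`, the terms with nonzero index add up to `1 - P`.
    rw [← Finset.mul_sum, eq_sub_of_add_eq' h1, mul_sub, mul_one, sub_mul, h0, one_mul]
    simp
  injective := h.injective
  tridiagonal b i j hij := by
    have hPQ : P * (1 - P) = 0 := by simp [mul_sub, hP]
    have hQP : (1 - P) * P = 0 := by simp [sub_mul, hP]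
    have hQ : (1 - P) * (1 - P) = 1 - P := by simp [mul_sub, sub_mul, hP]
    have hsum : ∑ l, θ (!b) l • (if l = 0 then P else (1 - P) * E (!b) l) =
        θ (!b) 0 • P + (1 - P) * ∑ l, θ (!b) l • E (!b) l := by
      rw [Fin.sum_univ_succ, Fin.sum_univ_succ]
      simp only [if_true, Fin.succ_ne_zero, if_false]
      rw [mul_add, mul_smul_comm, sub_mul, h0]
      simp [Finset.mul_sum]
    rw [hsum]
    set B := ∑ l, θ (!b) l • E (!b) l with hB
    have hPB : Commute P B := Commute.sum_right _ _ _ fun l _ => (hc _ l).smul_right _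
    have hQB := ((Commute.one_left B).sub_left hPB).eq
    have hQE := fun i => ((Commute.one_left (E b i)).sub_left (hc b i)).eq
    have hne : i ≠ j := by rintro rfl; omega
    have hl : P * (θ (!b) 0 • P + (1 - P) * B) = θ (!b) 0 • P := by
      rw [mul_add, mul_smul_comm, hP, ← mul_assoc, hPQ, zero_mul, add_zero]
    have hr : (θ (!b) 0 • P + (1 - P) * B) * P = θ (!b) 0 • P := by
      rw [add_mul, smul_mul_assoc, hP, mul_assoc, ← hPB.eq, ← mul_assoc, hQP, zero_mul, add_zero]
    split_ifs with hi hj hj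
    · exact absurd (hi.trans hj.symm) hne
    · rw [hl, smul_mul_assoc, ← mul_assoc, hPQ, zero_mul, smul_zero]
    · rw [mul_assoc, hr, mul_smul_comm, mul_assoc, ← (hc b i).eq, ← mul_assoc, hQP, zero_mul,
        smul_zero]
    · rw [mul_add, mul_smul_comm, mul_assoc (1 - P) _ P, ← (hc b i).eq, ← mul_assoc (1 - P), hQP,
        zero_mul, smul_zero, zero_add, hQE j, hQB]
      have : (1 - P) * E b i * (B * (1 - P)) * (E b j * (1 - P)) = 0 := by
        rw [mul_assoc (1 - P), ← mul_assoc (E b i), mul_assoc (1 - P), mul_assoc (E b i * B),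
          ← mul_assoc (1 - P) (E b j), hQE j, mul_assoc (E b j), hQ, ← mul_assoc (E b i * B),
          h.tridiagonal b i j hij]
        simp
      exact this

/-- In the deflated pair the idempotent of index `0` is `P` in both families. It commutes with
everything in sight, so index `0` is decoupled and `1` is a base. -/
theorem map_corner_one (h : IsTridiagonalPair E θ) (hn : 1 ≤ n) (hP : P * P = P)
    (hc : ∀ b i, Commute P (E b i)) (h0 : ∀ b, P * E b 0 = E b 0) {τ : R →ₗ[K] R}
    (hτ : ∀ b i, τ (E b i) = E b i) (hτP : τ P = P)
    (hmul : ∀ x y, τ (x * y) = τ y * τ x) {x : R}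
    (hx : x ∈ Algebra.adjoin K (Set.range fun b => ∑ i, θ b i • E b i)) :
    τ ((1 - P) * (E false 1 * x * E false 1)) = (1 - P) * (E false 1 * x * E false 1) := by
  have h10 : (1 : Fin (n + 1)) ≠ 0 := by
    obtain ⟨m, rfl⟩ : ∃ m, n = m + 1 := ⟨n - 1, by omega⟩
    simp
  have hQP : (1 - P) * P = 0 := by simp [sub_mul, hP]
  have hQ : (1 - P) * (1 - P) = 1 - P := by simp [mul_sub, sub_mul, hP]
  have hQE := fun b i => ((Commute.one_left (E b i)).sub_left (hc b i))
  have hτ1 : τ (1 - P) = 1 - P := by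
    rw [map_sub, hτP, ← h.sum_eq_one true, map_sum]
    simp_rw [hτ]
  have hd := h.deflate hP hc h0
  set E' : Bool → Fin (n + 1) → R := fun b i => if i = 0 then P else (1 - P) * E b i with hE'
  have hPE' : ∀ b i, Commute P (E' b i) := by
    intro b i
    simp only [hE']
    split_ifs
    · exact Commute.refl P
    · exact ((Commute.one_right P).sub_right (Commute.refl P)).mul_right (hc b i)
  have hQE' : ∀ b i, (1 - P) * E' b i = (1 - P) * E b i := by
    intro b i
    simp only [hE']
    split_ifs with hi
    · rw [hi, hQP, sub_mul, h0, one_mul, sub_self]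
    · rw [← mul_assoc, hQ]
  -- The generators of the two pairs agree after multiplication by `1 - P`, hence so do the algebras
  -- they generate.
  have key : ∃ x' ∈ Algebra.adjoin K (Set.range fun b => ∑ i, θ b i • E' b i),
      (1 - P) * x = (1 - P) * x' ∧ Commute (1 - P) x ∧ Commute (1 - P) x' := by
    induction hx using Algebra.adjoin_induction with
    | mem x hx =>
      obtain ⟨b, rfl⟩ := hx
      refine ⟨_, Algebra.subset_adjoin ⟨b, rfl⟩, ?_, ?_, ?_⟩
      · simp only [Finset.mul_sum, mul_smul_comm, hQE']
      · exact Commute.sum_right _ _ _ fun l _ => (hQE _ l).smul_right _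
      · exact Commute.sum_right _ _ _ fun l _ =>
          (((Commute.one_left _).sub_left (hPE' _ l))).smul_right _
    | algebraMap r =>
      exact ⟨_, Subalgebra.algebraMap_mem _ r, rfl, Algebra.commute_algebraMap_right _ _,
        Algebra.commute_algebraMap_right _ _⟩
    | add x y _ _ hx hy =>
      obtain ⟨x', hx', h1, h2, h3⟩ := hx
      obtain ⟨y', hy', h4, h5, h6⟩ := hy
      exact ⟨x' + y', add_mem hx' hy', by rw [mul_add, mul_add, h1, h4], h2.add_right h5,
        h3.add_right h6⟩
    | mul x y _ _ hx hy =>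
      obtain ⟨x', hx', h1, h2, h3⟩ := hx
      obtain ⟨y', hy', h4, h5, h6⟩ := hy
      exact ⟨x' * y', mul_mem hx' hy', by
        rw [← mul_assoc, h1, h3.eq, mul_assoc, h4, ← mul_assoc, ← h3.eq, mul_assoc],
        h2.mul_right h5, h3.mul_right h6⟩
  obtain ⟨x', hx', h1, h2, h3⟩ := key
  have hcorner := hd.map_corner_of_isBase 1 (τ := τ) (x := x') (by
    intro i j hi hj
    have hi0 : i = 0 := by
      obtain ⟨m, rfl⟩ : ∃ m, n = m + 1 := ⟨n - 1, by omega⟩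
      exact Fin.lt_one_iff i |>.1 hi
    have hj0 : j ≠ 0 := by
      rintro rfl
      exact absurd (lt_of_lt_of_le hi hj) (Fin.not_lt_zero i)
    subst hi0
    have hcomm : Commute P (∑ l, θ true l • E' true l) :=
      Commute.sum_right _ _ _ fun l _ => (hPE' _ l).smul_right _
    have h00 : E' false 0 = P := by simp [hE']
    have hz : P * E' false j = 0 := by rw [← h00]; exact hd.mul_of_ne _ _ _ hj0.symm
    rw [h00, hcomm.eq, mul_assoc, hz, mul_zero]
    refine ⟨rfl, ?_⟩
    rw [mul_assoc, ← hcomm.eq, ← mul_assoc, ← (hPE' false j).eq, hz, zero_mul]) (by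
    intro b i
    simp only [hE']
    split_ifs
    · exact hτP
    · rw [hmul, hτ, hτ1, (hQE b i).eq]) hmul hx'
  have he : E' false 1 * x' * E' false 1 = (1 - P) * (E false 1 * x * E false 1) := by
    have : E' false 1 = (1 - P) * E false 1 := by simp only [hE', h10, if_false]
    rw [this]
    calc (1 - P) * E false 1 * x' * ((1 - P) * E false 1)
        = E false 1 * ((1 - P) * x') * ((1 - P) * E false 1) := by
          rw [(hQE false 1).eq]; simp only [mul_assoc]
      _ = E false 1 * x * ((1 - P) * (1 - P)) * E false 1 := by
          rw [← h1, h2.eq]; simp only [mul_assoc]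
      _ = E false 1 * x * E false 1 * (1 - P) := by
          rw [hQ, mul_assoc _ (1 - P), (hQE false 1).eq, ← mul_assoc]
      _ = (1 - P) * (E false 1 * x * E false 1) :=
          (((hQE false 1).mul_right h2).mul_right (hQE false 1)).eq.symm
  rwa [he] at hcorner

end IsTridiagonalPair

/-! ### Spectral calculus for complete orthogonal idempotents. -/

namespace CompleteOrthogonalIdempotents

variable {K R ι : Type*} [Field K] [Ring R] [Algebra K R] [Fintype ι] {E : ι → R}

theorem sum_smul_mul (hE : CompleteOrthogonalIdempotents E) (θ : ι → K) (i : ι) :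
    (∑ l, θ l • E l) * E i = θ i • E i := by
  classical
  rw [Finset.sum_mul, Finset.sum_eq_single i]
  · rw [smul_mul_assoc, (hE.idem i).eq]
  · intro j _ hj
    rw [smul_mul_assoc, hE.ortho hj, smul_zero]
  · exact fun h => absurd (mem_univ i) h

theorem mul_sum_smul (hE : CompleteOrthogonalIdempotents E) (θ : ι → K) (i : ι) :
    E i * (∑ l, θ l • E l) = θ i • E i := by
  classical
  rw [Finset.mul_sum, Finset.sum_eq_single i]
  · rw [mul_smul_comm, (hE.idem i).eq]
  · intro j _ hj
    rw [mul_smul_comm, hE.ortho hj.symm, smul_zero]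
  · exact fun h => absurd (mem_univ i) h

theorem exists_aeval_eq (hE : CompleteOrthogonalIdempotents E) {θ : ι → K}
    (hθ : Function.Injective θ) (i : ι) :
    ∃ p : Polynomial K, Polynomial.aeval (∑ l, θ l • E l) p = E i := by
  classical
  have key : ∀ (p : Polynomial K) (j : ι),
      Polynomial.aeval (∑ l, θ l • E l) p * E j = p.eval (θ j) • E j := by
    intro p j
    induction p using Polynomial.induction_on' with
    | add p q hp hq => rw [map_add, add_mul, hp, hq, Polynomial.eval_add, add_smul]
    | monomial n c =>
      rw [Polynomial.aeval_monomial, Polynomial.eval_monomial, mul_assoc, ← Algebra.smul_def,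
        mul_smul]
      congr 1
      induction n with
      | zero => simp
      | succ n ih => rw [pow_succ, mul_assoc, hE.sum_smul_mul, mul_smul_comm, ih, smul_smul, pow_succ']
  refine ⟨Lagrange.basis univ θ i, ?_⟩
  rw [← mul_one (Polynomial.aeval _ _), ← hE.complete, Finset.mul_sum, Finset.sum_eq_single i]
  · rw [key, Lagrange.eval_basis_self (hθ.injOn) (mem_univ i), one_smul]
  · intro j _ hj
    rw [key, Lagrange.eval_basis_of_ne hj.symm (mem_univ j), zero_smul]
  · exact fun h => absurd (mem_univ i) h

theorem mem_adjoin (hE : CompleteOrthogonalIdempotents E) {θ : ι → K}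
    (hθ : Function.Injective θ) (i : ι) : E i ∈ Algebra.adjoin K {∑ l, θ l • E l} := by
  obtain ⟨p, hp⟩ := hE.exists_aeval_eq hθ i
  rw [← hp]
  exact Polynomial.aeval_mem_adjoin_singleton K _

theorem eq_of_mul_eq (hE : CompleteOrthogonalIdempotents E) {x : R} {i : ι}
    (h : ∀ j ≠ i, E j * x = 0) : E i * x = x := by
  classical
  conv_rhs => rw [← one_mul x, ← hE.complete, Finset.sum_mul]
  rw [Finset.sum_eq_single i]
  · exact fun j _ hj => h j hj
  · exact fun h => absurd (mem_univ i) h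

/-- An eigenvector of `∑ l, θ l • E l` with eigenvalue `θ i` lies in the range of `E i`. -/
theorem mul_eq_of_sum_smul_mul (hE : CompleteOrthogonalIdempotents E) {θ : ι → K}
    (hθ : Function.Injective θ) {x : R} {i : ι} (h : (∑ l, θ l • E l) * x = θ i • x) :
    E i * x = x := by
  refine hE.eq_of_mul_eq fun j hj => ?_
  have h1 : θ j • (E j * x) = θ i • (E j * x) := by
    rw [← smul_mul_assoc, ← hE.mul_sum_smul θ j, mul_assoc, h, mul_smul_comm]
  rw [← sub_eq_zero, ← sub_smul, smul_eq_zero, sub_eq_zero] at h1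
  exact h1.resolve_left fun h => hj (hθ h)

theorem commute_of_commute_sum (hE : CompleteOrthogonalIdempotents E) {θ : ι → K}
    (hθ : Function.Injective θ) {x : R} (h : Commute x (∑ l, θ l • E l)) (i : ι) :
    Commute x (E i) := by
  have hmem := hE.mem_adjoin hθ i
  generalize E i = e at hmem
  induction hmem using Algebra.adjoin_induction with
  | mem y hy => rw [Set.mem_singleton_iff.1 hy]; exact h
  | algebraMap r => exact Algebra.commute_algebraMap_right _ _
  | add y z _ _ hy hz => exact hy.add_right hz
  | mul y z _ _ hy hz => exact hy.mul_right hz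

theorem exists_mul_eq_smul (hE : CompleteOrthogonalIdempotents E) {x : R}
    (hx : x ∈ Submodule.span K (Set.range E)) (i : ι) :
    ∃ c : K, x * E i = c • E i ∧ E i * x = c • E i := by
  obtain ⟨c, rfl⟩ := (Submodule.mem_span_range_iff_exists_fun K).1 hx
  exact ⟨c i, hE.sum_smul_mul c i, hE.mul_sum_smul c i⟩

end CompleteOrthogonalIdempotents

/-! ### Primitive idempotents of the adjacency matrix. -/

namespace QPolyDRG

variable {X 𝕜 : Type*} [RCLike 𝕜] {G : SimpleGraph X}

theorem distMatrix_transpose (i : ℕ) : (distMatrix 𝕜 G i)ᵀ = distMatrix 𝕜 G i := by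
  ext y z
  simp [distMatrix, SimpleGraph.dist_comm]

theorem distMatrix_conjTranspose (i : ℕ) : (distMatrix 𝕜 G i)ᴴ = distMatrix 𝕜 G i := by
  ext y z
  simp only [distMatrix, Matrix.conjTranspose_apply, Matrix.of_apply, SimpleGraph.dist_comm]
  split_ifs <;> simp

theorem dualIdempotent_transpose [DecidableEq X] (x : X) (i : ℕ) :
    (dualIdempotent 𝕜 G x i)ᵀ = dualIdempotent 𝕜 G x i := Matrix.diagonal_transpose _

variable [Fintype X] [DecidableEq X]

/-- Two matrices that agree on all eigenspaces of a Hermitian matrix are equal. -/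
theorem eq_of_mulVec_eq_on_eigenspaces {A M N : Matrix X X 𝕜} (hA : A.IsHermitian)
    (h : ∀ μ, Module.End.HasEigenvalue (Matrix.toLin' A) μ →
      ∀ v ∈ Module.End.eigenspace (Matrix.toLin' A) μ, M *ᵥ v = N *ᵥ v) : M = N := by
  have key : Matrix.toEuclideanLin M = Matrix.toEuclideanLin N := by
    refine hA.eigenvectorBasis.toBasis.ext fun i => ?_
    rw [OrthonormalBasis.coe_toBasis]
    set v : X → 𝕜 := ⇑(hA.eigenvectorBasis i) with hv
    have hmem : v ∈ Module.End.eigenspace (Matrix.toLin' A) (hA.eigenvalues i : 𝕜) := by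
      rw [Module.End.mem_eigenspace_iff, Matrix.toLin'_apply, hA.mulVec_eigenvectorBasis]
      ext j
      simp [hv, RCLike.real_smul_eq_coe_mul]
    have hne : v ≠ 0 := by
      intro h0
      have := hA.eigenvectorBasis.orthonormal.ne_zero i
      apply this
      ext j
      exact congrFun h0 j
    have := h _ (Module.End.hasEigenvalue_of_hasEigenvector ⟨hmem, hne⟩) v hmem
    ext j
    exact congrFun this j
  exact Matrix.toEuclideanLin.injective key

/-- `E i` are the primitive idempotents of the adjacency matrix, with eigenvalues `θ i`, and
`θ 0` is the valency. -/
structure IsSpectralResolution (G : SimpleGraph X) {D : ℕ} (E : Fin (D + 1) → Matrix X X 𝕜)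
    (θ : Fin (D + 1) → 𝕜) : Prop where
  complete : CompleteOrthogonalIdempotents E
  injective : Function.Injective θ
  eq_sum : distMatrix 𝕜 G 1 = ∑ i, θ i • E i
  ne_zero : ∀ i, E i ≠ 0
  valency : ∀ y : X, θ 0 = ((Finset.univ.filter fun z => G.dist y z = 1).card : 𝕜)

section Idempotents

variable {D : ℕ} {E : Fin (D + 1) → Matrix X X 𝕜} {θ : Fin (D + 1) → 𝕜}

theorem IsIdempotentOrdering.exists_isSpectralResolution (h : IsIdempotentOrdering G E) :
    ∃ θ, IsSpectralResolution G E θ := by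
  obtain ⟨θ, hθ, hev, hval, hE⟩ := h
  have ext : ∀ M N : Matrix X X 𝕜, (∀ j, ∀ v ∈ Module.End.eigenspace
      (Matrix.toLin' (distMatrix 𝕜 G 1)) (θ j), M *ᵥ v = N *ᵥ v) → M = N := by
    intro M N h
    refine eq_of_mulVec_eq_on_eigenspaces (distMatrix_conjTranspose (𝕜 := 𝕜) (G := G) 1) ?_
    intro μ hμ
    obtain ⟨j, rfl⟩ := (hev μ).1 hμ
    exact h j
  have hsum : ∀ (c : Fin (D + 1) → 𝕜) (j : Fin (D + 1)), ∀ v ∈ Module.End.eigenspace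
      (Matrix.toLin' (distMatrix 𝕜 G 1)) (θ j), (∑ i, c i • E i) *ᵥ v = c j • v := by
    intro c j v hv
    rw [Matrix.sum_mulVec, Finset.sum_eq_single j]
    · rw [Matrix.smul_mulVec, hE j j v hv, if_pos rfl]
    · intro i _ hij
      rw [Matrix.smul_mulVec, hE i j v hv, if_neg hij, smul_zero]
    · exact fun h => absurd (mem_univ j) h
  refine ⟨θ, ⟨⟨fun i => ext _ _ fun j v hv => ?_, fun i k hik => ext _ _ fun j v hv => ?_⟩,
    ext _ _ fun j v hv => ?_⟩, hθ, ext _ _ fun j v hv => ?_, fun i h0 => ?_, hval⟩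
  · rw [← Matrix.mulVec_mulVec, hE i j v hv]
    split_ifs with hij
    · rw [hE i j v hv, if_pos hij]
    · simp
  · rw [← Matrix.mulVec_mulVec, hE k j v hv]
    split_ifs with hkj
    · subst hkj
      rw [hE i k v hv, if_neg hik]
      simp
    · simp
  · have := hsum 1 j v hv
    simpa using this
  · rw [hsum θ j v hv]
    exact Module.End.mem_eigenspace_iff.1 hv
  · obtain ⟨v, hv⟩ := ((hev (θ i)).2 ⟨i, rfl⟩).exists_hasEigenvector
    have := hE i i v hv.1
    rw [h0, if_pos rfl, Matrix.zero_mulVec] at this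
    exact hv.2 this.symm

namespace IsSpectralResolution

/-- The columns of `(E i)ᵀ` are `θ i`-eigenvectors because the adjacency matrix is symmetric, so `E
i * (E i)ᵀ = (E i)ᵀ`; the left side is symmetric. -/
theorem transpose (h : IsSpectralResolution G E θ) (i : Fin (D + 1)) : (E i)ᵀ = E i := by
  have h1 : E i * (E i)ᵀ = (E i)ᵀ := by
    refine h.complete.mul_eq_of_sum_smul_mul h.injective ?_
    rw [← h.eq_sum, ← distMatrix_transpose, ← Matrix.transpose_mul, h.eq_sum,
      h.complete.mul_sum_smul, Matrix.transpose_smul]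
  have h2 := congrArg Matrix.transpose h1
  rw [Matrix.transpose_mul, Matrix.transpose_transpose] at h2
  rw [← h1, h2]

open scoped ComplexOrder in
theorem star_eigenvalue (h : IsSpectralResolution G E θ) (i : Fin (D + 1)) :
    star (θ i) = θ i := by
  have h1 : distMatrix 𝕜 G 1 * (E i)ᴴ = star (θ i) • (E i)ᴴ := by
    rw [← distMatrix_conjTranspose, ← Matrix.conjTranspose_mul, h.eq_sum,
      h.complete.mul_sum_smul, Matrix.conjTranspose_smul]
  have h2 : E i * distMatrix 𝕜 G 1 * (E i)ᴴ = θ i • (E i * (E i)ᴴ) := by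
    rw [h.eq_sum, h.complete.mul_sum_smul, Matrix.smul_mul]
  rw [Matrix.mul_assoc, h1, Matrix.mul_smul, ← sub_eq_zero, ← sub_smul, smul_eq_zero,
    sub_eq_zero] at h2
  refine h2.resolve_right fun h0 => h.ne_zero i ?_
  exact Matrix.self_mul_conjTranspose_eq_zero.1 h0

theorem conjTranspose (h : IsSpectralResolution G E θ) (i : Fin (D + 1)) : (E i)ᴴ = E i := by
  have h1 : E i * (E i)ᴴ = (E i)ᴴ := by
    refine h.complete.mul_eq_of_sum_smul_mul h.injective ?_
    rw [← h.eq_sum, ← distMatrix_conjTranspose, ← Matrix.conjTranspose_mul, h.eq_sum,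
      h.complete.mul_sum_smul, Matrix.conjTranspose_smul, h.star_eigenvalue]
  have h2 := congrArg Matrix.conjTranspose h1
  rw [Matrix.conjTranspose_mul, Matrix.conjTranspose_conjTranspose] at h2
  rw [← h1, h2]

end IsSpectralResolution

end Idempotents

end QPolyDRG

/-! ### The Bose-Mesner algebra. -/

namespace QPolyDRG

variable {X 𝕜 : Type*} [RCLike 𝕜] {G : SimpleGraph X}

theorem exists_adj_dist_eq (hG : G.Connected) {y z : X} {k : ℕ} (h : G.dist y z = k + 1) :
    ∃ w, G.dist y w = 1 ∧ G.dist z w = k := by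
  obtain ⟨p, hp⟩ := hG.exists_walk_length_eq_dist y z
  cases p with
  | nil => simp at h
  | @cons _ w _ hadj p =>
    have h1 : G.dist y w = 1 := SimpleGraph.dist_eq_one_iff_adj.2 hadj
    refine ⟨w, h1, ?_⟩
    rw [SimpleGraph.Walk.length_cons] at hp
    have h2 := SimpleGraph.dist_le p
    have h3 := hG.dist_triangle (u := y) (v := w) (w := z)
    rw [SimpleGraph.dist_comm]
    omega

theorem exists_dist_eq_of_le_diam (hG : G.Connected) {k : ℕ}
    (hk : k ≤ G.diam) : ∃ y z, G.dist y z = k := by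
  have := hG.nonempty
  obtain ⟨n, hn⟩ := Nat.exists_eq_add_of_le hk
  clear hk
  induction n generalizing k with
  | zero => rw [add_zero] at hn; rw [← hn]; exact SimpleGraph.exists_dist_eq_diam
  | succ n ih =>
    obtain ⟨y, z, h⟩ := ih (k := k + 1) (by omega)
    obtain ⟨w, -, hw⟩ := exists_adj_dist_eq hG h
    exact ⟨z, w, hw⟩

theorem distMatrix_zero [DecidableEq X] (hG : G.Connected) : distMatrix 𝕜 G 0 = 1 := by
  ext y z
  simp only [distMatrix, Matrix.of_apply, Matrix.one_apply, hG.dist_eq_zero_iff]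

variable [Fintype X]

theorem dist_le_of_diam_eq (hG : G.Connected) {D : ℕ} (hD : G.diam = D) (y z : X) :
    G.dist y z ≤ D := by
  have := hG.nonempty
  rw [← hD]
  exact SimpleGraph.dist_le_diam (SimpleGraph.connected_iff_ediam_ne_top.1 hG)

/-- The intersection numbers of a distance-regular graph. -/
theorem IsDistanceRegular.exists_intersectionNumbers (hG : IsDistanceRegular G) :
    ∃ p : ℕ → ℕ → ℕ → ℕ, ∀ (i j : ℕ) (y z : X),
      (Finset.univ.filter fun w => G.dist y w = i ∧ G.dist z w = j).card = p (G.dist y z) i j := by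
  classical
  refine ⟨fun h i j => if hh : ∃ yz : X × X, G.dist yz.1 yz.2 = h then
    (Finset.univ.filter fun w => G.dist hh.choose.1 w = i ∧ G.dist hh.choose.2 w = j).card else 0,
    fun i j y z => ?_⟩
  have hh : ∃ yz : X × X, G.dist yz.1 yz.2 = G.dist y z := ⟨(y, z), rfl⟩
  beta_reduce
  rw [dif_pos hh]
  exact hG.card_eq _ _ _ _ _ _ _ rfl hh.choose_spec

theorem distMatrix_mul_apply (i j : ℕ) (y z : X) :
    (distMatrix 𝕜 G i * distMatrix 𝕜 G j) y z =
      ((Finset.univ.filter fun w => G.dist y w = i ∧ G.dist z w = j).card : 𝕜) := by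
  rw [Matrix.mul_apply, Finset.card_filter, Nat.cast_sum]
  refine Finset.sum_congr rfl fun w _ => ?_
  simp only [distMatrix, Matrix.of_apply]
  rw [G.dist_comm (u := w) (v := z)]
  by_cases h1 : G.dist y w = i <;> by_cases h2 : G.dist z w = j <;> simp [h1, h2]

theorem distMatrix_one_mul (hG : G.Connected) {p : ℕ → ℕ → ℕ → ℕ}
    (hp : ∀ (i j : ℕ) (y z : X),
      (Finset.univ.filter fun w => G.dist y w = i ∧ G.dist z w = j).card = p (G.dist y z) i j)
    (k : ℕ) : distMatrix 𝕜 G 1 * distMatrix 𝕜 G k =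
      ∑ h ∈ range (k + 2), (p h 1 k : 𝕜) • distMatrix 𝕜 G h := by
  ext y z
  rw [distMatrix_mul_apply, Matrix.sum_apply]
  simp only [Matrix.smul_apply, distMatrix, Matrix.of_apply, smul_eq_mul, mul_ite, mul_one,
    mul_zero]
  rw [Finset.sum_ite_eq (range (k + 2)) (G.dist y z), hp]
  split_ifs with hmem
  · rfl
  · rw [← hp, Nat.cast_eq_zero, Finset.card_eq_zero, Finset.filter_eq_empty_iff]
    rintro w - ⟨h1, h2⟩
    have h3 := hG.dist_triangle (u := y) (v := w) (w := z)
    rw [G.dist_comm (u := w)] at h3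
    simp only [mem_range] at hmem
    omega

theorem mem_boseMesner_iff {M : Matrix X X 𝕜} :
    M ∈ boseMesner 𝕜 G ↔ ∃ f : ℕ → 𝕜, ∀ y z, M y z = f (G.dist y z) := by
  constructor
  · intro h
    induction h using Submodule.span_induction with
    | mem M hM =>
      obtain ⟨i, rfl⟩ := hM
      exact ⟨fun k => if k = i then 1 else 0, fun y z => rfl⟩
    | zero => exact ⟨0, fun y z => rfl⟩
    | add M N _ _ h1 h2 =>
      obtain ⟨f, hf⟩ := h1
      obtain ⟨g, hg⟩ := h2
      exact ⟨f + g, fun y z => by simp [hf, hg]⟩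
    | smul c M _ h =>
      obtain ⟨f, hf⟩ := h
      exact ⟨c • f, fun y z => by simp [hf]⟩
  · rintro ⟨f, hf⟩
    have : M = ∑ k ∈ range (univ.sup (fun yz : X × X => G.dist yz.1 yz.2) + 1),
        f k • distMatrix 𝕜 G k := by
      ext y z
      rw [Matrix.sum_apply]
      simp only [Matrix.smul_apply, distMatrix, Matrix.of_apply, smul_eq_mul, mul_ite, mul_one,
        mul_zero]
      rw [Finset.sum_ite_eq, if_pos, hf]
      rw [mem_range, Nat.lt_succ_iff]
      exact Finset.le_sup (f := fun yz : X × X => G.dist yz.1 yz.2) (mem_univ (y, z))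
    rw [this]
    exact Submodule.sum_mem _ fun k _ => Submodule.smul_mem _ _ (Submodule.subset_span ⟨k, rfl⟩)

variable [DecidableEq X]

variable {D : ℕ} {E : Fin (D + 1) → Matrix X X 𝕜} {θ : Fin (D + 1) → 𝕜}

namespace IsSpectralResolution

theorem mem_boseMesner (hS : IsSpectralResolution G E θ) (hG : IsDistanceRegular G)
    (i : Fin (D + 1)) : E i ∈ boseMesner 𝕜 G := by
  obtain ⟨p, hp⟩ := hG.exists_intersectionNumbers
  have hmul : ∀ N ∈ boseMesner 𝕜 G, distMatrix 𝕜 G 1 * N ∈ boseMesner 𝕜 G := by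
    intro N hN
    induction hN using Submodule.span_induction with
    | mem N hN =>
      obtain ⟨k, rfl⟩ := hN
      rw [distMatrix_one_mul hG.connected hp]
      exact Submodule.sum_mem _ fun h _ => Submodule.smul_mem _ _ (Submodule.subset_span ⟨h, rfl⟩)
    | zero => simp
    | add M N _ _ h1 h2 => rw [mul_add]; exact Submodule.add_mem _ h1 h2
    | smul c M _ h => rw [Matrix.mul_smul]; exact Submodule.smul_mem _ _ h
  have hpow : ∀ n, distMatrix 𝕜 G 1 ^ n ∈ boseMesner 𝕜 G := by
    intro n
    induction n with
    | zero =>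
      rw [pow_zero, ← distMatrix_zero (𝕜 := 𝕜) hG.connected]
      exact Submodule.subset_span ⟨0, rfl⟩
    | succ n ih => rw [pow_succ']; exact hmul _ ih
  obtain ⟨q, hq⟩ := hS.complete.exists_aeval_eq hS.injective i
  rw [← hq, ← hS.eq_sum, Polynomial.aeval_eq_sum_range]
  exact Submodule.sum_mem _ fun n _ => Submodule.smul_mem _ _ (hpow n)

theorem mul_mem_span (hS : IsSpectralResolution G E θ) {N : Matrix X X 𝕜}
    (hN : N ∈ Submodule.span 𝕜 (Set.range E)) :
    distMatrix 𝕜 G 1 * N ∈ Submodule.span 𝕜 (Set.range E) := by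
  obtain ⟨c, rfl⟩ := (Submodule.mem_span_range_iff_exists_fun 𝕜).1 hN
  rw [hS.eq_sum, Finset.mul_sum]
  refine Submodule.sum_mem _ fun i _ => ?_
  rw [Matrix.mul_smul, hS.complete.sum_smul_mul]
  exact Submodule.smul_mem _ _ (Submodule.smul_mem _ _ (Submodule.subset_span ⟨i, rfl⟩))

/-- The recurrence for `A * A_k` can be solved for `A_{k+1}`: its coefficient counts neighbours one
step closer, which exist on a geodesic. Beyond the diameter `A_{k+1} = 0`. -/
theorem distMatrix_mem_span (hS : IsSpectralResolution G E θ) (hG : IsDistanceRegular G) (k : ℕ) :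
    distMatrix 𝕜 G k ∈ Submodule.span 𝕜 (Set.range E) := by
  obtain ⟨p, hp⟩ := hG.exists_intersectionNumbers
  induction k using Nat.strong_induction_on with
  | _ k ih =>
    rcases k with _ | k
    · rw [distMatrix_zero hG.connected, ← hS.complete.complete]
      exact Submodule.sum_mem _ fun i _ => Submodule.subset_span ⟨i, rfl⟩
    · by_cases hk : ∃ y z, G.dist y z = k + 1
      · obtain ⟨y, z, hyz⟩ := hk
        obtain ⟨w, hw⟩ := exists_adj_dist_eq hG.connected hyz
        have hne : (p (k + 1) 1 k : 𝕜) ≠ 0 := by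
          rw [Nat.cast_ne_zero, ← hyz, ← hp]
          exact (Finset.card_pos.2 ⟨w, by simpa using hw⟩).ne'
        have h1 := distMatrix_one_mul (𝕜 := 𝕜) hG.connected hp k
        rw [Finset.sum_range_succ] at h1
        have h2 : distMatrix 𝕜 G (k + 1) = (p (k + 1) 1 k : 𝕜)⁻¹ •
            (distMatrix 𝕜 G 1 * distMatrix 𝕜 G k -
              ∑ h ∈ range (k + 1), (p h 1 k : 𝕜) • distMatrix 𝕜 G h) := by
          rw [h1, add_sub_cancel_left, smul_smul, inv_mul_cancel₀ hne, one_smul]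
        rw [h2]
        refine Submodule.smul_mem _ _ (Submodule.sub_mem _ (hS.mul_mem_span (ih k (by omega))) ?_)
        exact Submodule.sum_mem _ fun h hh => Submodule.smul_mem _ _ (ih h (mem_range.1 hh))
      · push Not at hk
        have : distMatrix 𝕜 G (k + 1) = 0 := by
          ext y z
          simp [distMatrix, hk y z]
        rw [this]
        exact Submodule.zero_mem _

theorem boseMesner_le_span (hS : IsSpectralResolution G E θ) (hG : IsDistanceRegular G) :
    boseMesner 𝕜 G ≤ Submodule.span 𝕜 (Set.range E) := by
  rw [boseMesner, Submodule.span_le]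
  rintro _ ⟨k, rfl⟩
  exact hS.distMatrix_mem_span hG k

/-- The trivial idempotent is a multiple of the all-ones matrix. -/
theorem card_smul_zero (hS : IsSpectralResolution G E θ) (hG : IsDistanceRegular G) :
    (Fintype.card X : 𝕜) • E 0 = Matrix.of fun _ _ => 1 := by
  set J : Matrix X X 𝕜 := Matrix.of fun _ _ => 1 with hJ
  have hJmem : J ∈ boseMesner 𝕜 G := mem_boseMesner_iff.2 ⟨fun _ => 1, fun y z => rfl⟩
  obtain ⟨c, -, hc⟩ := hS.complete.exists_mul_eq_smul (hS.boseMesner_le_span hG hJmem) 0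
  have hAJ : distMatrix 𝕜 G 1 * J = θ 0 • J := by
    ext y z
    rw [Matrix.mul_apply, Matrix.smul_apply, hS.valency y, Finset.card_filter, Nat.cast_sum]
    simp [distMatrix, hJ]
  have hEJ : E 0 * J = J := by
    refine hS.complete.mul_eq_of_sum_smul_mul hS.injective ?_
    rw [← hS.eq_sum, hAJ]
  have hJJ : J * J = (Fintype.card X : 𝕜) • J := by
    ext y z
    simp [Matrix.mul_apply, hJ]
  rw [hEJ] at hc
  have hne : J ≠ 0 := by
    obtain ⟨y⟩ := hG.connected.nonempty
    intro h0
    have := congrFun (congrFun h0 y) y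
    simp [hJ] at this
  have h1 : (Fintype.card X : 𝕜) • J = c • J := by
    calc (Fintype.card X : 𝕜) • J = (c • E 0) * J := by rw [← hJJ, ← hc]
      _ = c • J := by rw [Matrix.smul_mul, hEJ]
  rw [← sub_eq_zero, ← sub_smul, smul_eq_zero, sub_eq_zero] at h1
  rw [h1.resolve_right hne, ← hc]

end IsSpectralResolution

end QPolyDRG

/-! ### Dual idempotents, the projection onto sphere-constant functions, and the tridiagonal
relations. -/

namespace QPolyDRG

variable {X 𝕜 : Type*} [RCLike 𝕜] {G : SimpleGraph X}

theorem sum_smul_dualIdempotent [DecidableEq X] {D : ℕ} (hd : ∀ y z, G.dist y z ≤ D) (x : X) (f : ℕ → 𝕜) :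
    ∑ i : Fin (D + 1), f i • dualIdempotent 𝕜 G x i =
      Matrix.diagonal fun y => f (G.dist x y) := by
  rw [Fin.sum_univ_eq_sum_range (fun i => f i • dualIdempotent 𝕜 G x i)]
  ext y z
  rw [Matrix.sum_apply]
  simp only [dualIdempotent, Matrix.smul_apply, Matrix.diagonal_apply, smul_eq_mul]
  split_ifs with hyz
  · simp only [mul_ite, mul_one, mul_zero]
    rw [Finset.sum_ite_eq, if_pos]
    have := hd x y
    simp only [mem_range]
    omega
  · simp

variable [Fintype X]

/-- The projection onto the space of vectors that are constant on the spheres around `x`. -/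
noncomputable def sphereProjection (𝕜 : Type*) [RCLike 𝕜] (G : SimpleGraph X) (x : X) :
    Matrix X X 𝕜 :=
  Matrix.of fun y z => if G.dist x y = G.dist x z then
    ((univ.filter fun w => G.dist x w = G.dist x y).card : 𝕜)⁻¹ else 0

theorem sphereProjection_transpose (x : X) :
    (sphereProjection 𝕜 G x)ᵀ = sphereProjection 𝕜 G x := by
  ext y z
  simp only [sphereProjection, Matrix.transpose_apply, Matrix.of_apply]
  by_cases h : G.dist x y = G.dist x z
  · simp [h]
  · simp [h, Ne.symm h]

theorem sphereProjection_mul_of_forall_eq (x : X) {N : Matrix X X 𝕜}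
    (hN : ∀ y y' z, G.dist x y = G.dist x y' → N y z = N y' z) :
    sphereProjection 𝕜 G x * N = N := by
  ext y z
  rw [Matrix.mul_apply]
  simp only [sphereProjection, Matrix.of_apply, ite_mul, zero_mul]
  rw [← Finset.sum_filter]
  have h1 : ∀ w ∈ univ.filter (fun w => G.dist x y = G.dist x w),
      ((univ.filter fun w => G.dist x w = G.dist x y).card : 𝕜)⁻¹ * N w z =
      ((univ.filter fun w => G.dist x w = G.dist x y).card : 𝕜)⁻¹ * N y z := by
    intro w hw
    rw [hN y w z (Finset.mem_filter.1 hw).2]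
  rw [Finset.sum_congr rfl h1, Finset.sum_const, nsmul_eq_mul, ← mul_assoc]
  have h2 : (univ.filter fun w => G.dist x y = G.dist x w) =
      univ.filter fun w => G.dist x w = G.dist x y := by
    ext w; simp [eq_comm]
  rw [h2, mul_inv_cancel₀, one_mul]
  rw [Nat.cast_ne_zero]
  exact (Finset.card_pos.2 ⟨y, by simp⟩).ne'

theorem sphereProjection_mul_self (x : X) :
    sphereProjection 𝕜 G x * sphereProjection 𝕜 G x = sphereProjection 𝕜 G x := by
  refine sphereProjection_mul_of_forall_eq x fun y y' z h => ?_
  simp only [sphereProjection, Matrix.of_apply, h]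

/-- By distance-regularity `A` preserves the functions constant on spheres, so `P A P = A P`;
transposing gives `P A P = P A`. -/
theorem commute_sphereProjection_distMatrix (hG : IsDistanceRegular G) (x : X) :
    Commute (sphereProjection 𝕜 G x) (distMatrix 𝕜 G 1) := by
  obtain ⟨p, hp⟩ := hG.exists_intersectionNumbers
  set P := sphereProjection 𝕜 G x with hP
  set A := distMatrix 𝕜 G 1 with hA
  have h1 : P * (A * P) = A * P := by
    refine sphereProjection_mul_of_forall_eq x fun y y' z h => ?_
    have key : ∀ y, (A * P) y z =
        p (G.dist x y) 1 (G.dist x z) *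
          ((univ.filter fun w => G.dist x w = G.dist x z).card : 𝕜)⁻¹ := by
      intro y
      rw [G.dist_comm (u := x) (v := y), ← hp 1 (G.dist x z) y x, Finset.card_filter, Nat.cast_sum,
        Finset.sum_mul, Matrix.mul_apply]
      refine Finset.sum_congr rfl fun w _ => ?_
      simp only [hA, hP, distMatrix, sphereProjection, Matrix.of_apply]
      by_cases h1 : G.dist y w = 1 <;> by_cases h2 : G.dist x w = G.dist x z <;> simp [h1, h2]
    rw [key, key, h]
  have h2 := congrArg Matrix.transpose h1
  rw [Matrix.transpose_mul, Matrix.transpose_mul, hP, sphereProjection_transpose, hA,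
    distMatrix_transpose, ← hP, ← hA] at h2
  change P * A = A * P
  rw [← h2, Matrix.mul_assoc, h1]

variable [DecidableEq X] {D : ℕ} {E : Fin (D + 1) → Matrix X X 𝕜} {θ : Fin (D + 1) → 𝕜}

theorem completeOrthogonalIdempotents_dualIdempotent (hd : ∀ y z, G.dist y z ≤ D) (x : X) :
    CompleteOrthogonalIdempotents fun i : Fin (D + 1) => dualIdempotent 𝕜 G x i where
  idem i := by
    change dualIdempotent 𝕜 G x i * dualIdempotent 𝕜 G x i = _
    rw [dualIdempotent, Matrix.diagonal_mul_diagonal]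
    congr 1
    funext y
    split_ifs <;> simp
  ortho i j hij := by
    change dualIdempotent 𝕜 G x i * dualIdempotent 𝕜 G x j = 0
    rw [dualIdempotent, dualIdempotent, Matrix.diagonal_mul_diagonal, ← Matrix.diagonal_zero]
    congr 1
    funext y
    have : (i : ℕ) ≠ j := fun h => hij (Fin.ext h)
    split_ifs
    · omega
    all_goals simp
  complete := by
    have := sum_smul_dualIdempotent (𝕜 := 𝕜) hd x 1
    simpa using this

theorem dualIdempotent_mul_distMatrix_mul_dualIdempotent (hG : G.Connected) (x : X) {i j : ℕ}
    (hij : i + 1 < j ∨ j + 1 < i) :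
    dualIdempotent 𝕜 G x i * distMatrix 𝕜 G 1 * dualIdempotent 𝕜 G x j = 0 := by
  ext y z
  rw [dualIdempotent, dualIdempotent, Matrix.mul_diagonal, Matrix.diagonal_mul]
  simp only [distMatrix, Matrix.of_apply, Matrix.zero_apply]
  by_cases h1 : G.dist x y = i
  swap
  · simp [h1]
  by_cases h2 : G.dist x z = j
  swap
  · simp [h2]
  have h3 : G.dist y z ≠ 1 := by
    intro h3
    have h4 := hG.dist_triangle (u := x) (v := y) (w := z)
    have h5 := hG.dist_triangle (u := x) (v := z) (w := y)
    rw [G.dist_comm (u := z)] at h5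
    omega
  simp [h3]

namespace IsSpectralResolution

open scoped ComplexOrder in
/-- The triple product relations between the idempotents and the dual distance matrices. -/
theorem mul_diagonal_mul_eq_zero (hS : IsSpectralResolution G E θ)
    {q : Fin (D + 1) → Fin (D + 1) → Fin (D + 1) → 𝕜} (hq : IsKreinParameters E q)
    {h i j : Fin (D + 1)} (h0 : q h i j = 0) (x : X) :
    E i * Matrix.diagonal (fun y => E h x y) * E j = 0 := by
  set d : Matrix X X 𝕜 := Matrix.diagonal fun y => E h x y with hd
  have hsymm : ∀ l y z, E l y z = E l z y := fun l y z => by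
    conv_lhs => rw [← hS.transpose l]
    rfl
  have hstar : ∀ y, star (E h x y) = E h x y := fun y => by
    rw [hsymm h x y]
    conv_rhs => rw [← hS.conjTranspose h]
    rw [Matrix.conjTranspose_apply, hsymm h x y]
  have hdstar : dᴴ = d := by
    rw [hd, Matrix.diagonal_conjTranspose]
    congr 1
    funext y
    exact hstar y
  -- The squared Frobenius norm of `E i * d * E j` equals the `(x, x)`-entry of `E h * (E i ⊙ E j) *
  -- E h`, which is zero because the coefficient of `E h` in `E i ⊙ E j` is.
  rw [← Matrix.trace_conjTranspose_mul_self_eq_zero_iff, Matrix.conjTranspose_mul,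
    Matrix.conjTranspose_mul, hS.conjTranspose, hS.conjTranspose, hdstar]
  have h1 : E j * (d * E i) * (E i * d * E j) = E j * (d * E i * d * E j) := by
    have := (hS.complete.idem i).eq
    calc E j * (d * E i) * (E i * d * E j) = E j * (d * (E i * E i) * d * E j) := by
          simp only [Matrix.mul_assoc]
      _ = _ := by rw [this]
  rw [h1, Matrix.trace_mul_comm, Matrix.mul_assoc _ (E j), (hS.complete.idem j).eq,
    Matrix.mul_assoc]
  have h2 : E h * (E i ⊙ E j) * E h = 0 := by
    rw [hq i j, Matrix.mul_smul, Finset.mul_sum, Matrix.smul_mul, Finset.sum_mul,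
      Finset.sum_eq_zero, smul_zero]
    intro l _
    by_cases hl : l = h
    · rw [hl, h0]; simp
    · rw [Matrix.mul_smul, hS.complete.ortho (Ne.symm hl)]; simp
  have h3 := congrFun (congrFun h2 x) x
  rw [Matrix.mul_apply] at h3
  rw [Matrix.trace]
  refine Eq.trans ?_ h3
  refine Finset.sum_congr rfl fun y _ => ?_
  rw [Matrix.diag_apply, Matrix.mul_apply, Matrix.mul_apply, Finset.sum_mul]
  refine Finset.sum_congr rfl fun z _ => ?_
  rw [hd, Matrix.diagonal_mul, Matrix.diagonal_mul, Matrix.hadamard_apply, hsymm h y x,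
    hsymm i z y, hsymm j z y]
  ring

/-- The dual eigenvalues of a `Q`-polynomial structure are distinct. -/
theorem injOn_of_isQPolynomial (hS : IsSpectralResolution G E θ) (hG : IsDistanceRegular G)
    (hD : G.diam = D) (hD1 : 1 ≤ D) (hQ : IsQPolynomial E) {f : ℕ → 𝕜}
    (hf : ∀ y z, E 1 y z = f (G.dist y z)) : Set.InjOn f (Set.Iic D) := by
  obtain ⟨q, hq, hq0, hqne⟩ := hQ
  have hX : (Fintype.card X : 𝕜) ≠ 0 := by
    have := hG.connected.nonempty
    rw [Nat.cast_ne_zero]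
    exact Fintype.card_ne_zero
  have hone : ((1 : Fin (D + 1)) : ℕ) = 1 := by
    rw [Fin.val_one', Nat.mod_eq_of_lt (by omega)]
  intro a ha b hb hab
  obtain ⟨y, z, hyz⟩ := exists_dist_eq_of_le_diam hG.connected (k := a) (by rw [hD]; exact ha)
  obtain ⟨y', z', hyz'⟩ := exists_dist_eq_of_le_diam hG.connected (k := b) (by rw [hD]; exact hb)
  have hE1 : E 1 y z = E 1 y' z' := by rw [hf, hf, hyz, hyz', hab]
  -- The `E_{n+1}` term of `E_1 ∘ E_n` has nonzero coefficient and all others have index at most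
  -- `n`. So equal entries of `E_1` force equal entries of every `E_n`, hence of `A_a`, which tells
  -- distance `a` from distance `b`.
  have key : ∀ n, ∀ hn : n < D + 1, E ⟨n, hn⟩ y z = E ⟨n, hn⟩ y' z' := by
    intro n
    induction n using Nat.strong_induction_on with
    | _ n ih =>
      intro hn
      rcases n with _ | n
      · have h0 := hS.card_smul_zero hG
        have h1 := congrFun (congrFun h0 y) z
        have h2 := congrFun (congrFun h0 y') z'
        have h3 := h1.trans h2.symm
        exact mul_left_cancel₀ hX h3
      · set j : Fin (D + 1) := ⟨n, by omega⟩ with hj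
        set k : Fin (D + 1) := ⟨n + 1, hn⟩ with hk
        have hprod := hq 1 j
        have e1 := congrFun (congrFun hprod y) z
        have e2 := congrFun (congrFun hprod y') z'
        have hjE : E j y z = E j y' z' := ih n (by omega) _
        rw [Matrix.hadamard_apply, Matrix.smul_apply, Matrix.sum_apply] at e1 e2
        rw [hE1, hjE, e2] at e1
        have e3 := mul_left_cancel₀ (inv_ne_zero hX) e1
        rw [← Finset.add_sum_erase _ _ (mem_univ k), ← Finset.add_sum_erase _ _ (mem_univ k)] at e3
        have e4 : ∑ h ∈ univ.erase k, (q h 1 j • E h) y z =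
            ∑ h ∈ univ.erase k, (q h 1 j • E h) y' z' := by
          refine Finset.sum_congr rfl fun h hh => ?_
          have hne : (h : ℕ) ≠ n + 1 := fun hc => (Finset.mem_erase.1 hh).1 (Fin.ext hc)
          rw [Matrix.smul_apply, Matrix.smul_apply]
          rcases lt_or_gt_of_ne hne with hlt | hgt
          · rw [ih h hlt h.2]
          · rw [hq0 h 1 j (Or.inl (by rw [hone, hj]; simp only; omega)), zero_smul, zero_smul]
        rw [e4, add_left_inj] at e3
        have hqk : q k 1 j ≠ 0 := hqne k 1 j (Or.inl (by rw [hone, hj, hk]; simp only; omega))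
        exact (mul_left_cancel₀ hqk e3).symm
  have hA := hS.distMatrix_mem_span hG a
  obtain ⟨c, hc⟩ := (Submodule.mem_span_range_iff_exists_fun 𝕜).1 hA
  have h1 : distMatrix 𝕜 G a y z = distMatrix 𝕜 G a y' z' := by
    rw [← hc, Matrix.sum_apply, Matrix.sum_apply]
    refine Finset.sum_congr rfl fun i _ => ?_
    rw [Matrix.smul_apply, Matrix.smul_apply, key i i.2]
  simp only [distMatrix, Matrix.of_apply, hyz, hyz', if_true] at h1
  by_contra hne
  rw [if_neg (Ne.symm hne)] at h1
  exact one_ne_zero h1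

/-- The primitive idempotents and the dual primitive idempotents of a `Q`-polynomial
distance-regular graph. -/
theorem exists_isTridiagonalPair (hS : IsSpectralResolution G E θ) (hG : IsDistanceRegular G)
    (hD : G.diam = D) (hD1 : 1 ≤ D) (hQ : IsQPolynomial E) (x : X) :
    ∃ f : Fin (D + 1) → 𝕜, IsTridiagonalPair
      (fun b i => cond b (E i) (dualIdempotent 𝕜 G x i)) (fun b i => cond b (θ i) (f i)) := by
  obtain ⟨f, hf⟩ := mem_boseMesner_iff.1 (hS.mem_boseMesner hG 1)
  have hdist := dist_le_of_diam_eq hG.connected hD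
  have hEs := completeOrthogonalIdempotents_dualIdempotent (𝕜 := 𝕜) hdist x
  have hone : ((1 : Fin (D + 1)) : ℕ) = 1 := by
    rw [Fin.val_one', Nat.mod_eq_of_lt (by omega)]
  have hinj := hS.injOn_of_isQPolynomial hG hD hD1 hQ hf
  refine ⟨fun i => f i, ⟨?_, ?_, ?_, ?_, ?_⟩⟩
  · rintro (_ | _) i
    · exact (hEs.idem i).eq
    · exact (hS.complete.idem i).eq
  · rintro (_ | _) i j hij
    · exact hEs.ortho hij
    · exact hS.complete.ortho hij
  · rintro (_ | _)
    · exact hEs.complete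
    · exact hS.complete.complete
  · rintro (_ | _)
    · intro i j hij
      exact Fin.ext (hinj (Nat.lt_succ_iff.1 i.2) (Nat.lt_succ_iff.1 j.2) hij)
    · exact hS.injective
  · rintro (_ | _) i j hij
    · simp only [cond_false, Bool.not_false, cond_true]
      rw [← hS.eq_sum]
      exact dualIdempotent_mul_distMatrix_mul_dualIdempotent hG.connected x hij
    · simp only [cond_false, Bool.not_true, cond_true]
      rw [sum_smul_dualIdempotent hdist x f]
      obtain ⟨q, hq, hq0, -⟩ := hQ
      have : (Matrix.diagonal fun y => f (G.dist x y)) =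
          Matrix.diagonal fun y => E 1 x y := by
        congr 1
        funext y
        rw [hf]
      rw [this]
      exact hS.mul_diagonal_mul_eq_zero hq (hq0 1 i j (by rw [hone]; omega)) x

end IsSpectralResolution

theorem commute_sphereProjection_dualIdempotent (x : X) (i : ℕ) :
    Commute (sphereProjection 𝕜 G x) (dualIdempotent 𝕜 G x i) := by
  ext y z
  rw [dualIdempotent, Matrix.mul_diagonal, Matrix.diagonal_mul]
  simp only [sphereProjection, Matrix.of_apply]
  by_cases h : G.dist x y = G.dist x z
  · simp [h]
  · simp [h]

end QPolyDRG

/-! ### The rank-one part of the corners, and the assembly. -/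

namespace QPolyDRG

variable {X 𝕜 : Type*} [RCLike 𝕜] {G : SimpleGraph X}

theorem dualIdempotent_zero_eq_single [DecidableEq X] (hG : G.Connected) (x : X) :
    dualIdempotent 𝕜 G x 0 = Matrix.single x x 1 := by
  ext y z
  simp only [dualIdempotent, Matrix.diagonal_apply, Matrix.single_apply, hG.dist_eq_zero_iff]
  by_cases h1 : x = y
  · subst h1
    by_cases h2 : x = z <;> simp [h2]
  · simp [h1]

variable [Fintype X]

theorem ones_mul_mul_ones (N : Matrix X X 𝕜) :
    ∃ s : 𝕜, (Matrix.of fun _ _ => 1) * N * (Matrix.of fun _ _ => 1) =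
      s • (Matrix.of fun _ _ => 1 : Matrix X X 𝕜) := by
  refine ⟨∑ w, ∑ v, N v w, ?_⟩
  ext y z
  simp [Matrix.mul_apply]

/-- If `P * e` is a multiple of `e * F * e` with `F` of rank one, then `P * (e * B * e)` is
symmetric. -/
theorem transpose_mul_corner {P e F B : Matrix X X 𝕜} {c : 𝕜} (hPe : P * e = c • (e * F * e))
    (he : eᵀ = e) (hF : Fᵀ = F) (hFF : ∀ N, ∃ s : 𝕜, F * N * F = s • F) (hP : P * P = P)
    (hc : Commute P e) (hB : Commute P B) : (P * (e * B * e))ᵀ = P * (e * B * e) := by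
  obtain ⟨s, hs⟩ := hFF (e * B * e)
  have : P * (e * B * e) = (c * (c * s)) • (e * F * e) := by
    -- One copy of `P` is moved to each `e`; then `F` compresses everything between to a scalar.
    calc P * (e * B * e) = P * P * e * B * e := by rw [hP]; simp only [mul_assoc]
      _ = (P * e) * B * (P * e) := by
        rw [mul_assoc P P e, hc.eq, ← mul_assoc, hc.eq, mul_assoc _ P B, hB.eq]
        simp only [mul_assoc]
        rw [hc.eq]
      _ = (c * c) • (e * (F * (e * B * e) * F) * e) := by
        rw [hPe, Matrix.smul_mul, Matrix.smul_mul, Matrix.mul_smul, smul_smul]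
        simp only [mul_assoc]
      _ = (c * (c * s)) • (e * F * e) := by
        rw [hs, Matrix.mul_smul, Matrix.smul_mul, smul_smul, mul_assoc]
  rw [this, Matrix.transpose_smul, Matrix.transpose_mul, Matrix.transpose_mul, he, hF, mul_assoc]

variable [DecidableEq X]

theorem dualIdempotent_zero_mul_mul (hG : G.Connected) (x : X) (N : Matrix X X 𝕜) :
    ∃ s : 𝕜, dualIdempotent 𝕜 G x 0 * N * dualIdempotent 𝕜 G x 0 =
      s • dualIdempotent 𝕜 G x 0 := by
  refine ⟨N x x, ?_⟩
  rw [dualIdempotent_zero_eq_single hG, Matrix.single_mul_mul_single, Matrix.smul_single]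
  simp

theorem sphereProjection_mul_dualIdempotent (x : X) (i : ℕ) :
    ∃ c : 𝕜, sphereProjection 𝕜 G x * dualIdempotent 𝕜 G x i =
      c • (dualIdempotent 𝕜 G x i * (Matrix.of fun _ _ => 1) * dualIdempotent 𝕜 G x i) := by
  refine ⟨((univ.filter fun w => G.dist x w = i).card : 𝕜)⁻¹, ?_⟩
  ext y z
  rw [Matrix.smul_apply]
  simp only [dualIdempotent]
  rw [Matrix.mul_diagonal, Matrix.mul_diagonal, Matrix.diagonal_mul]
  simp only [sphereProjection, Matrix.of_apply]
  by_cases h2 : G.dist x z = i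
  swap
  · simp [h2]
  by_cases h1 : G.dist x y = i
  · simp [h1, h2]
  · simp [h1, h2]

/-- `A_k E_0^* A_k` is the rank-one matrix built from the indicator of the sphere of radius `k`.
Since each `A_k` acts on `E i` as a scalar, this makes `P * E i` a multiple of `E i * E_0^* * E i`.
-/
theorem sphereProjection_eq_sum (hG : G.Connected) {D : ℕ} (hd : ∀ y z, G.dist y z ≤ D) (x : X) :
    sphereProjection 𝕜 G x = ∑ k ∈ range (D + 1),
      ((univ.filter fun w => G.dist x w = k).card : 𝕜)⁻¹ •
        (distMatrix 𝕜 G k * dualIdempotent 𝕜 G x 0 * distMatrix 𝕜 G k) := by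
  ext y z
  have h : ∀ k, (distMatrix 𝕜 G k * dualIdempotent 𝕜 G x 0 * distMatrix 𝕜 G k) y z =
      if k = G.dist x y then (if G.dist x y = G.dist x z then 1 else 0) else 0 := by
    intro k
    rw [dualIdempotent_zero_eq_single hG, Matrix.mul_apply, Finset.sum_eq_single x]
    · rw [Matrix.mul_single_apply_same]
      simp only [distMatrix, Matrix.of_apply, mul_one]
      rw [G.dist_comm (u := y)]
      by_cases h1 : k = G.dist x y
      · subst h1
        by_cases h2 : G.dist x y = G.dist x z
        · simp [h2]
        · simp [h2, Ne.symm h2]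
      · simp [h1, Ne.symm h1]
    · intro w _ hw
      rw [Matrix.mul_single_apply_of_ne _ _ _ _ _ hw, zero_mul]
    · exact fun h => absurd (mem_univ x) h
  rw [Matrix.sum_apply]
  simp_rw [Matrix.smul_apply, h, smul_eq_mul, mul_ite, mul_zero]
  rw [Finset.sum_ite_eq', if_pos (by have := hd x y; simp only [mem_range]; omega)]
  simp [sphereProjection]

variable {D : ℕ} {E : Fin (D + 1) → Matrix X X 𝕜} {θ : Fin (D + 1) → 𝕜}

namespace IsSpectralResolution

theorem commute_sphereProjection (hS : IsSpectralResolution G E θ) (hG : IsDistanceRegular G)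
    (x : X) (i : Fin (D + 1)) : Commute (sphereProjection 𝕜 G x) (E i) :=
  hS.complete.commute_of_commute_sum hS.injective
    (hS.eq_sum ▸ commute_sphereProjection_distMatrix hG x) i

theorem sphereProjection_mul (hS : IsSpectralResolution G E θ) (hG : IsDistanceRegular G)
    (hd : ∀ y z, G.dist y z ≤ D) (x : X) (i : Fin (D + 1)) :
    ∃ c : 𝕜, sphereProjection 𝕜 G x * E i = c • (E i * dualIdempotent 𝕜 G x 0 * E i) := by
  choose a ha using fun k => hS.complete.exists_mul_eq_smul (hS.distMatrix_mem_span hG k) i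
  refine ⟨∑ k ∈ range (D + 1),
    ((univ.filter fun w => G.dist x w = k).card : 𝕜)⁻¹ * (a k * a k), ?_⟩
  have h1 : sphereProjection 𝕜 G x * E i = E i * sphereProjection 𝕜 G x * E i := by
    rw [← (hS.commute_sphereProjection hG x i).eq, mul_assoc, (hS.complete.idem i).eq]
  rw [h1, sphereProjection_eq_sum hG.connected hd, Finset.mul_sum, Finset.sum_mul, Finset.sum_smul]
  refine Finset.sum_congr rfl fun k _ => ?_
  rw [Matrix.mul_smul, Matrix.smul_mul, mul_smul]
  congr 1
  rw [← mul_assoc, ← mul_assoc, (ha k).2, mul_assoc, (ha k).1, Matrix.smul_mul, Matrix.mul_smul,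
    Matrix.smul_mul, smul_smul]

theorem sphereProjection_mul_zero (hS : IsSpectralResolution G E θ) (hG : IsDistanceRegular G)
    (x : X) : sphereProjection 𝕜 G x * E 0 = E 0 := by
  refine sphereProjection_mul_of_forall_eq x fun y y' z _ => ?_
  have hX : (Fintype.card X : 𝕜) ≠ 0 := by
    have := hG.connected.nonempty
    rw [Nat.cast_ne_zero]
    exact Fintype.card_ne_zero
  have h0 := hS.card_smul_zero hG
  have h1 := congrFun (congrFun h0 y) z
  have h2 := congrFun (congrFun h0 y') z
  exact mul_left_cancel₀ hX (h1.trans h2.symm)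

end IsSpectralResolution

theorem sphereProjection_mul_dualIdempotent_zero (hG : G.Connected) (x : X) :
    sphereProjection 𝕜 G x * dualIdempotent 𝕜 G x 0 = dualIdempotent 𝕜 G x 0 := by
  refine sphereProjection_mul_of_forall_eq x fun y y' z h => ?_
  rw [dualIdempotent_zero_eq_single hG, Matrix.single_apply, Matrix.single_apply]
  have : x = y ↔ x = y' := by rw [← hG.dist_eq_zero_iff, ← hG.dist_eq_zero_iff, h]
  simp only [this]

/-- A corner `e T e` with `e ∈ T` idempotent is an algebra with identity `e`. It is commutative if
it consists of symmetric matrices. -/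
theorem corner_properties (T : Subalgebra 𝕜 (Matrix X X 𝕜)) {e : Matrix X X 𝕜} (heT : e ∈ T)
    (he : e * e = e) (hsymm : ∀ B ∈ T, (e * B * e)ᵀ = e * B * e) :
    IsAlgebraWithOne (corner T e) e ∧ (∀ a ∈ corner T e, ∀ b ∈ corner T e, a * b = b * a) ∧
      (∀ a ∈ corner T e, aᵀ = a) := by
  have hmem : ∀ a, a ∈ corner T e ↔ ∃ B ∈ T, e * B * e = a := fun a => by
    simp [corner, Submodule.mem_map, LinearMap.mulLeftRight_apply]
  have hT : ∀ a ∈ corner T e, aᵀ = a := by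
    intro a ha
    obtain ⟨B, hB, rfl⟩ := (hmem a).1 ha
    exact hsymm B hB
  have hmul : ∀ a ∈ corner T e, ∀ b ∈ corner T e, a * b ∈ corner T e := by
    intro a ha b hb
    obtain ⟨B, hB, rfl⟩ := (hmem a).1 ha
    obtain ⟨C, hC, rfl⟩ := (hmem b).1 hb
    refine (hmem _).2 ⟨B * e * C, mul_mem (mul_mem hB heT) hC, ?_⟩
    calc e * (B * e * C) * e = e * B * e * C * e := by simp only [mul_assoc]
      _ = e * B * (e * e) * C * e := by rw [he]
      _ = e * B * e * (e * C * e) := by simp only [mul_assoc]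
  refine ⟨⟨(hmem e).2 ⟨1, one_mem T, by rw [mul_one, he]⟩, hmul, ?_, ?_⟩, ?_, hT⟩
  · intro a ha
    obtain ⟨B, hB, rfl⟩ := (hmem a).1 ha
    rw [← mul_assoc, ← mul_assoc, he]
  · intro a ha
    obtain ⟨B, hB, rfl⟩ := (hmem a).1 ha
    rw [mul_assoc, he]
  · intro a ha b hb
    have h := hT _ (hmul a ha b hb)
    rw [Matrix.transpose_mul, hT a ha, hT b hb] at h
    exact h.symm

/-- As the eigenvalues are distinct, Lagrange interpolation recovers each idempotent from its
generator. -/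
theorem terwilliger_le_adjoin (hS : IsSpectralResolution G E θ) (hG : IsDistanceRegular G)
    (hd : ∀ y z, G.dist y z ≤ D) (x : X) {f : Fin (D + 1) → 𝕜} (hf : Function.Injective f) :
    terwilliger 𝕜 G x ≤ Algebra.adjoin 𝕜 (Set.range fun b => ∑ i, (cond b (θ i) (f i)) •
      (cond b (E i) (dualIdempotent 𝕜 G x i))) := by
  set S := Algebra.adjoin 𝕜 (Set.range fun b => ∑ i, (cond b (θ i) (f i)) •
      (cond b (E i) (dualIdempotent 𝕜 G x i))) with hSdef
  have hEs := completeOrthogonalIdempotents_dualIdempotent (𝕜 := 𝕜) hd x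
  have hS' : ∀ b : Bool, Algebra.adjoin 𝕜 {∑ i, (cond b (θ i) (f i)) •
      (cond b (E i) (dualIdempotent 𝕜 G x i))} ≤ S := fun b =>
    Algebra.adjoin_mono (Set.singleton_subset_iff.2 (Set.mem_range_self b))
  have h1 : ∀ i, E i ∈ S := fun i => hS' true (hS.complete.mem_adjoin hS.injective i)
  have h2 : ∀ i : Fin (D + 1), dualIdempotent 𝕜 G x i ∈ S := fun i =>
    hS' false (hEs.mem_adjoin hf i)
  rw [terwilliger, Algebra.adjoin_le_iff]
  rintro M (hM | hM)
  · have h3 : Submodule.span 𝕜 (Set.range E) ≤ Subalgebra.toSubmodule S := by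
      rw [Submodule.span_le]
      rintro _ ⟨i, rfl⟩
      exact h1 i
    exact h3 (hS.boseMesner_le_span hG hM)
  · have h3 : dualBoseMesner 𝕜 G x ≤ Subalgebra.toSubmodule S := by
      rw [dualBoseMesner, Submodule.span_le]
      rintro _ ⟨k, rfl⟩
      by_cases hk : k < D + 1
      · exact h2 ⟨k, hk⟩
      · have : dualIdempotent 𝕜 G x k = 0 := by
          rw [dualIdempotent, ← Matrix.diagonal_zero]
          congr 1
          funext y
          rw [if_neg]
          have := hd x y
          omega
        rw [this]
        exact zero_mem S
    exact h3 hM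

theorem corner_terwilliger (hG : IsDistanceRegular G) (hdiam : G.diam = D) (hD : 1 ≤ D)
    (hE : IsIdempotentOrdering G E) (hQ : IsQPolynomial E) (x : X) :
    ∀ e ∈ ({dualIdempotent 𝕜 G x 1, E 1, dualIdempotent 𝕜 G x D, E (Fin.last D)} :
        Set (Matrix X X 𝕜)),
      IsAlgebraWithOne (corner (terwilliger 𝕜 G x) e) e ∧
      (∀ a ∈ corner (terwilliger 𝕜 G x) e, ∀ b ∈ corner (terwilliger 𝕜 G x) e, a * b = b * a) ∧
      (∀ a ∈ corner (terwilliger 𝕜 G x) e, aᵀ = a) := by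
  obtain ⟨θ, hS⟩ := hE.exists_isSpectralResolution
  obtain ⟨f, hf⟩ := hS.exists_isTridiagonalPair hG hdiam hD hQ x
  have hd := dist_le_of_diam_eq hG.connected hdiam
  have hone : ((1 : Fin (D + 1)) : ℕ) = 1 := by
    rw [Fin.val_one', Nat.mod_eq_of_lt (by omega)]
  set P := sphereProjection 𝕜 G x with hPdef
  have hPP : P * P = P := sphereProjection_mul_self x
  have hPt : Pᵀ = P := sphereProjection_transpose x
  set F : Bool → Fin (D + 1) → Matrix X X 𝕜 :=
    fun b i => cond b (E i) (dualIdempotent 𝕜 G x i) with hF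
  set T := terwilliger 𝕜 G x with hT
  have hadj : ∀ B ∈ T, B ∈ Algebra.adjoin 𝕜
      (Set.range fun b => ∑ i, (cond b (θ i) (f i)) • F b i) :=
    fun B hB => terwilliger_le_adjoin hS hG hd x (hf.injective false) hB
  have hadj' : ∀ B ∈ T, B ∈ Algebra.adjoin 𝕜
      (Set.range fun b => ∑ i, (cond (!b) (θ i) (f i)) • F (!b) i) := by
    intro B hB
    have h1 : (Set.range fun b => ∑ i, (cond (!b) (θ i) (f i)) • F (!b) i) =
        Set.range fun b => ∑ i, (cond b (θ i) (f i)) • F b i :=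
      Function.Surjective.range_comp (g := fun b => ∑ i, (cond b (θ i) (f i)) • F b i)
        Bool.involutive_not.surjective
    rw [h1]
    exact hadj B hB
  have hFt : ∀ b i, (F b i)ᵀ = F b i := by
    rintro (_ | _) i
    · exact dualIdempotent_transpose x i
    · exact hS.transpose i
  have hFc : ∀ b i, Commute P (F b i) := by
    rintro (_ | _) i
    · exact commute_sphereProjection_dualIdempotent x i
    · exact hS.commute_sphereProjection hG x i
  have hF0 : ∀ b, P * F b 0 = F b 0 := by
    rintro (_ | _)
    · exact sphereProjection_mul_dualIdempotent_zero hG.connected x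
    · exact hS.sphereProjection_mul_zero hG x
  have hFT : ∀ b i, F b i ∈ T := by
    rintro (_ | _) i
    · exact Algebra.subset_adjoin (Or.inr (Submodule.subset_span ⟨i, rfl⟩))
    · exact Algebra.subset_adjoin (Or.inl (hS.mem_boseMesner hG i))
  have hPB : ∀ B ∈ T, Commute P B := by
    intro B hB
    have hB' := hadj B hB
    clear hB
    induction hB' using Algebra.adjoin_induction with
    | mem y hy =>
      obtain ⟨b, rfl⟩ := hy
      exact Commute.sum_right _ _ _ fun i _ => (hFc b i).smul_right _
    | algebraMap r => exact Algebra.commute_algebraMap_right _ _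
    | add y z _ _ hy hz => exact hy.add_right hz
    | mul y z _ _ hy hz => exact hy.mul_right hz
  set τ : Matrix X X 𝕜 →ₗ[𝕜] Matrix X X 𝕜 := (Matrix.transposeLinearEquiv X X 𝕜 𝕜).toLinearMap
    with hτ
  have hτa : ∀ M, τ M = Mᵀ := fun M => rfl
  have hτmul : ∀ M N, τ (M * N) = τ N * τ M := fun M N => Matrix.transpose_mul M N
  -- For index `1`, symmetry is checked separately on the ranges of `1 - P` and `P`.
  have hsplit : ∀ e B : Matrix X X 𝕜, τ ((1 - P) * (e * B * e)) = (1 - P) * (e * B * e) →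
      (P * (e * B * e))ᵀ = P * (e * B * e) → (e * B * e)ᵀ = e * B * e := by
    intro e B h1 h2
    have h3 : e * B * e = (1 - P) * (e * B * e) + P * (e * B * e) := by
      rw [sub_mul, one_mul, sub_add_cancel]
    rw [h3, Matrix.transpose_add, h2, ← hτa, h1]
  rintro e (rfl | rfl | rfl | rfl)
  · have he : dualIdempotent 𝕜 G x 1 = F false 1 := by
      simp only [hF, cond_false, hone]
    rw [he]
    refine corner_properties T (hFT _ _) (hf.mul_self _ _) fun B hB => hsplit _ _ ?_ ?_
    · exact hf.map_corner_one hD hPP hFc hF0 hFt hPt hτmul (hadj B hB)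
    · obtain ⟨c, hc⟩ := sphereProjection_mul_dualIdempotent (𝕜 := 𝕜) (G := G) x
        ((1 : Fin (D + 1)) : ℕ)
      exact transpose_mul_corner hc (hFt false 1) rfl ones_mul_mul_ones hPP (hFc false 1) (hPB B hB)
  · refine corner_properties T (hFT true 1) (hf.mul_self true 1) fun B hB => hsplit _ _ ?_ ?_
    · exact hf.dual.map_corner_one hD hPP (fun b => hFc !b) (fun b => hF0 !b) (fun b => hFt !b)
        hPt hτmul (hadj' B hB)
    · obtain ⟨c, hc⟩ := hS.sphereProjection_mul hG hd x 1
      exact transpose_mul_corner hc (hFt true 1) (dualIdempotent_transpose x 0)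
        (dualIdempotent_zero_mul_mul hG.connected x) hPP (hFc true 1) (hPB B hB)
  · have he : dualIdempotent 𝕜 G x D = F false (Fin.last D) := by simp [hF]
    rw [he]
    exact corner_properties T (hFT _ _) (hf.mul_self _ _) fun B hB =>
      hf.map_corner_last hFt hτmul (hadj B hB)
  · exact corner_properties T (hFT true _) (hf.mul_self true _) fun B hB =>
      hf.dual.map_corner_last (fun b => hFt !b) hτmul (hadj' B hB)

end QPolyDRG

end

theorem theorem1p6 {𝕜 : Type*} [RCLike 𝕜] {X : Type*} [Fintype X] [DecidableEq X]
    (G : SimpleGraph X) (hG : QPolyDRG.IsDistanceRegular G)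
    (D : ℕ) (hdiam : G.diam = D) (hD : 3 ≤ D)
    (E : Fin (D + 1) → Matrix X X 𝕜) (hE : QPolyDRG.IsIdempotentOrdering G E)
    (hQ : QPolyDRG.IsQPolynomial E) (x : X) :
    ∀ e ∈ ({QPolyDRG.dualIdempotent 𝕜 G x 1, E 1,
        QPolyDRG.dualIdempotent 𝕜 G x D, E (Fin.last D)} : Set (Matrix X X 𝕜)),
      QPolyDRG.IsAlgebraWithOne (QPolyDRG.corner (QPolyDRG.terwilliger 𝕜 G x) e) e ∧
      (∀ a ∈ QPolyDRG.corner (QPolyDRG.terwilliger 𝕜 G x) e,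
        ∀ b ∈ QPolyDRG.corner (QPolyDRG.terwilliger 𝕜 G x) e, a * b = b * a) ∧
      (∀ a ∈ QPolyDRG.corner (QPolyDRG.terwilliger 𝕜 G x) e, aᵀ = a) :=
  QPolyDRG.corner_terwilliger hG hdiam (by omega) hE hQ x
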